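/- Let $\mathsf{BS}^{(2)}=\langle a,b,c \mid ab=ba^2,\ bc=cb^2\rangle$ be the iterated Baumslag--Solitar group. Consider words in the seven letters $a^{\pm1},b^{\pm1},c^{\pm1}$ and $e$, where $e$ is a letter standing for the identity; the length $|w|$ counts all letters of $w$, including $e$. A derivation from $w$ to $w'$ is a finite sequence of words $w\to u_1\to\cdots\to u_n\to w'$ in which each arrow replaces a subword by means of a single relation, used in either direction, from the list $ab=baa$, $bc=cbb$, $xx^{-1}=e$, $ex=x$, $xe=x$ ($x$ any letter, $e^{-1}:=e$). Its expansion length is the maximal length of a word occurring in it, and $\mathsf{EL}(w,w')$ is the minimum of the expansion lengths of all derivations from $w$ to $w'$. Let $K_{e,L}$ be the set of words of length $L$ that represent the identity of $\mathsf{BS}^{(2)}$, and let $$\mathsf{EL}(L)=\max_{w,w'\in K_{e,L}}\mathsf{EL}(w,w')$$ be the expansion length (filling length) function of $\mathsf{BS}^{(2)}$. Then $\mathsf{BS}^{(2)}$ has exponential expansion length, $\mathsf{EL}(L)\sim 2^L$ in the scaling sense: there is an integer $C\ge 1$ such that for all $L\ge 1$ $$2^{\lfloor L/C\rfloor}\ \le\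 \mathsf{EL}(L)\ \le\ 2^{CL}.$$ -/

import Mathlib

/-- The full set of letters attached to a set `S` of generators: the trivial letter `e`,
the generators `s`, and their formal inverses. -/
inductive Letter (S : Type) : Type
  | e : Letter S
  | gen : S → Letter S
  | inv : S → Letter S

/-- The formal inverse of a letter. -/
def Letter.inverse {S : Type} : Letter S → Letter S
  | Letter.e => Letter.e
  | Letter.gen s => Letter.inv s
  | Letter.inv s => Letter.gen s

/-- Words in the letters `e, s, s⁻¹`. The length `|w|` of a word counts all letters,
including `e`. -/
abbrev Word (S : Type) : Type := List (Letter S)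

/-- The element of the free group defined by a letter. -/
def Letter.toFreeGroup {S : Type} : Letter S → FreeGroup S
  | Letter.e => 1
  | Letter.gen s => FreeGroup.of s
  | Letter.inv s => (FreeGroup.of s)⁻¹

/-- The element of the free group defined by a word. -/
def Word.toFreeGroup {S : Type} (w : Word S) : FreeGroup S :=
  (w.map Letter.toFreeGroup).prod

/-- The relators `l r⁻¹` of a set `R` of relations `l = r` between words. -/
def relators {S : Type} (R : Set (Word S × Word S)) : Set (FreeGroup S) :=
  {x | ∃ p ∈ R, x = Word.toFreeGroup p.1 * (Word.toFreeGroup p.2)⁻¹}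

/-- The group `⟨S | R⟩`, for a set `R` of relations `l = r` between words. -/
abbrev RelGroup {S : Type} (R : Set (Word S × Word S)) : Type :=
  PresentedGroup (relators R)

/-- The element `φ(w)` of `⟨S | R⟩` represented by a word `w`. -/
def Word.eval {S : Type} (R : Set (Word S × Word S)) (w : Word S) : RelGroup R :=
  PresentedGroup.mk (relators R) (Word.toFreeGroup w)

/-- The complete list of relations of the group presentation `⟨S | R⟩` as a presentation by the
letters `e, s, s⁻¹`: those in `R`, together with the trivial relations `x x⁻¹ = e` and
`e x = x = x e` that are left implicit in a group presentation. -/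
inductive Rule {S : Type} (R : Set (Word S × Word S)) : Word S → Word S → Prop
  | rel (l r : Word S) : (l, r) ∈ R → Rule R l r
  | cancel (x : Letter S) : Rule R [x, x.inverse] [Letter.e]
  | e_left (x : Letter S) : Rule R [Letter.e, x] [x]
  | e_right (x : Letter S) : Rule R [x, Letter.e] [x]

/-- `w → w'`: one application of a single relation, in either direction, to a subword. -/
def Step {S : Type} (R : Set (Word S × Word S)) (w w' : Word S) : Prop :=
  ∃ u v l r : Word S, (Rule R l r ∨ Rule R r l) ∧ w = u ++ l ++ v ∧ w' = u ++ r ++ v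

/-- `D` is a derivation `w → u₁ → ⋯ → uₙ → w'`, listed with its two end words. -/
def IsDerivation {S : Type} (R : Set (Word S × Word S)) (w w' : Word S)
    (D : List (Word S)) : Prop :=
  D.IsChain (Step R) ∧ D.head? = some w ∧ D.getLast? = some w'

/-- The expansion length of a derivation: the maximal length of a word occurring in it. -/
noncomputable def derivationEL {S : Type} (D : List (Word S)) : ℕ∞ :=
  ⨆ u ∈ D, (u.length : ℕ∞)

/-- The relative expansion length `EL(w, w')`: the minimal expansion length of a derivation from
`w` to `w'` (it is `⊤` if there is no derivation). -/
noncomputable def relativeEL {S : Type} (R : Set (Word S × Word S)) (w w' : Word S) : ℕ∞ :=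
  ⨅ (D : List (Word S)) (_ : IsDerivation R w w' D), derivationEL D

/-- The sector `K_{g,L}`: the words of length `L` that represent `g`. -/
def sector {S : Type} (R : Set (Word S × Word S)) (g : RelGroup R) (L : ℕ) : Set (Word S) :=
  {w | w.length = L ∧ Word.eval R w = g}

/-- `EL_g(L)`: the maximum of `EL(w, w')` over `w, w'` in `K_{g,L}`. -/
noncomputable def sectorEL {S : Type} (R : Set (Word S × Word S)) (g : RelGroup R) (L : ℕ) : ℕ∞ :=
  ⨆ (w ∈ sector R g L) (w' ∈ sector R g L), relativeEL R w w'

/-- The expansion length `EL(L) = EL_1(L)` of the group presentation `⟨S | R⟩`. -/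
noncomputable def expansionLength {S : Type} (R : Set (Word S × Word S)) (L : ℕ) : ℕ∞ :=
  sectorEL R 1 L

/-- `f ∼ g` in the scaling sense: for some constant `C`, `g(L/C) ≤ f(L) ≤ g(CL)` for all
lengths `L ≥ 1` (`L / C` is rounded down). -/
def ScalingEquiv (f g : ℕ → ℕ∞) : Prop :=
  ∃ C : ℕ, 1 ≤ C ∧ ∀ L : ℕ, 1 ≤ L → g (L / C) ≤ f L ∧ f L ≤ g (C * L)

/-- The three generators of the iterated Baumslag-Solitar group. -/
inductive BSGen : Type
  | a : BSGen
  | b : BSGen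
  | c : BSGen

/-- The defining relations of the iterated Baumslag-Solitar group
`BS⁽²⁾ = ⟨a, b, c | a b = b a², b c = c b²⟩`. -/
def iteratedBS : Set (Word BSGen × Word BSGen) :=
  {([Letter.gen BSGen.a, Letter.gen BSGen.b],
      [Letter.gen BSGen.b, Letter.gen BSGen.a, Letter.gen BSGen.a]),
   ([Letter.gen BSGen.b, Letter.gen BSGen.c],
      [Letter.gen BSGen.c, Letter.gen BSGen.b, Letter.gen BSGen.b])}

/-! Lower bound. The group is made to act on `ℚ × ℤ`, with `a` translating by `2 ^ k` at height `k`
and `b` lowering the height by one. All that is asked of `c` is that it conjugate `b` to its square.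
Each `a`-edge gets an integer weight. An edge of height `k + 1` weighs as much as the two edges of
height `k` that the relation `ab = baa` puts in its place, plus one if its starting point lies in `2
^ (k + 1) ℤ`. One rewriting step therefore changes the weight of a path by at most 1. The commutator
`deepWord n` has length `8 n + 8` and is trivial, because `c⁻ⁿ b cⁿ = b ^ (2 ^ n)` turns `a` into a
power of `a`. Its weight from the origin is `2 ^ 2 ^ n - 1`, while words in `e` weigh 0. A
derivation between them meets every weight in between, hence at least `2 ^ 2 ^ n` distinct words. At
most `8 ^ Q` words have length at most `Q`, so some word has length of order `2 ^ n`
(`card_le_of_injective_word`, `le_relativeEL_of_pathWeight`).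

Upper bound. Only the size of intermediate words matters, not the number of steps. A word of length
`n` is read letter by letter and kept in Britton-reduced form for the HNN extension with stable
letter `c⁻¹`. Its syllables are products of at most `n` conjugates `b⁻ʰ a^±1 bʰ` and a power of `b`,
with exponents at most `4 ^ n` (`IsReducedForm.mul_genC`). Each pinch needs a syllable equal to a
power of `b` to be rewritten as that power. Its conjugates represent signed powers of 2 with sum 0,
and they are merged like binary carries, in space polynomial in the exponents (`conjA_comm`,
`prodConjA_of_dyadicSum_eq_zero`). Britton's lemma then forces the reduced form of a trivial word to
have no `c` left, and one last use of the same merging rewrites it to the identity. -/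

/-! ### The lower bound -/

section LowerBound

/-- The generator `a` as a permutation of `ℚ × ℤ`. -/
def permA : Equiv.Perm (ℚ × ℤ) where
  toFun p := (p.1 + 2 ^ p.2, p.2)
  invFun p := (p.1 - 2 ^ p.2, p.2)
  left_inv p := by simp
  right_inv p := by simp

/-- The generator `b` as a permutation of `ℚ × ℤ`. -/
def permB : Equiv.Perm (ℚ × ℤ) where
  toFun p := (p.1, p.2 - 1)
  invFun p := (p.1, p.2 + 1)
  left_inv p := by simp
  right_inv p := by simp

/-- A bijection between the orbits of `permB` and the orbits of its square. -/
noncomputable def orbitEquiv : ℚ ≃ ℚ × Fin 2 :=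
  (nonempty_equiv_of_countable (α := ℚ) (β := ℚ × Fin 2)).some

/-- The generator `c` as a permutation of `ℚ × ℤ`: it conjugates `permB` to its square. -/
noncomputable def permC : Equiv.Perm (ℚ × ℤ) :=
  (orbitEquiv.prodCongr (Equiv.refl ℤ)).trans
    ((Equiv.prodAssoc ℚ (Fin 2) ℤ).trans
      ((Equiv.refl ℚ).prodCongr ((Equiv.prodComm (Fin 2) ℤ).trans (Int.divModEquiv 2).symm)))

lemma permC_apply (p : ℚ × ℤ) :
    permC p = ((orbitEquiv p.1).1, p.2 * 2 + ((orbitEquiv p.1).2 : ℕ)) := by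
  simp [permC]

lemma permB_permA (p : ℚ × ℤ) : permB (permA p) = permA (permA (permB p)) := by
  ext
  · simp only [permA, permB, Equiv.coe_fn_mk]
    rw [show (2 : ℚ) ^ p.2 = 2 ^ (p.2 - 1) * 2 by
      rw [← zpow_add_one₀ (by norm_num)]; simp]
    ring
  · simp [permA, permB]

lemma permC_permB (p : ℚ × ℤ) : permC (permB p) = permB (permB (permC p)) := by
  rw [permC_apply, permC_apply]
  ext
  · simp [permB]
  · simp [permB]; ring

/-- The right action of the generators on `ℚ × ℤ`. -/
noncomputable def genPerm : BSGen → Equiv.Perm (ℚ × ℤ)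
  | BSGen.a => permA
  | BSGen.b => permB
  | BSGen.c => permC

/-- The right action of the letters on `ℚ × ℤ`. -/
noncomputable def letterPerm : Letter BSGen → Equiv.Perm (ℚ × ℤ)
  | Letter.e => 1
  | Letter.gen s => genPerm s
  | Letter.inv s => (genPerm s)⁻¹

/-- The end point of the path labelled `w` that starts at a given point. -/
noncomputable def walk : Word BSGen → ℚ × ℤ → ℚ × ℤ
  | [], p => p
  | x :: w, p => walk w (letterPerm x p)

/-! ### Weights that change slowly under rewriting -/

open Classical in
/-- The weight of the `a`-edge that starts at the point `(x, k)`. -/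
noncomputable def edgeWeight : ℕ → ℚ → ℤ
  | 0, _ => 0
  | k + 1, x => edgeWeight k x + edgeWeight k (x + 2 ^ k) +
      if ∃ m : ℤ, x = m * 2 ^ (k + 1) then 1 else 0

/-- The signed weight of the edge with a given label that starts at a given point. -/
noncomputable def letterWeight : Letter BSGen → ℚ × ℤ → ℤ
  | Letter.gen BSGen.a, p => edgeWeight p.2.toNat p.1
  | Letter.inv BSGen.a, p => - edgeWeight (permA⁻¹ p).2.toNat (permA⁻¹ p).1
  | _, _ => 0

/-- The total weight of the path labelled `w` that starts at a given point. -/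
noncomputable def pathWeight : Word BSGen → ℚ × ℤ → ℤ
  | [], _ => 0
  | x :: w, p => letterWeight x p + pathWeight w (letterPerm x p)

lemma walk_append (u v : Word BSGen) (p : ℚ × ℤ) : walk (u ++ v) p = walk v (walk u p) := by
  induction u generalizing p with
  | nil => rfl
  | cons x u ih => simp [walk, ih]

lemma pathWeight_append (u v : Word BSGen) (p : ℚ × ℤ) :
    pathWeight (u ++ v) p = pathWeight u p + pathWeight v (walk u p) := by
  induction u generalizing p with
  | nil => simp [pathWeight, walk]
  | cons x u ih => simp [walk, pathWeight, ih, add_assoc]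

lemma walk_rule {l r : Word BSGen} (h : Rule iteratedBS l r) (p : ℚ × ℤ) :
    walk l p = walk r p := by
  cases h with
  | rel l r h =>
    simp only [iteratedBS, Set.mem_insert_iff, Set.mem_singleton_iff, Prod.mk.injEq] at h
    rcases h with ⟨rfl, rfl⟩ | ⟨rfl, rfl⟩
    · simpa [walk, letterPerm, genPerm] using permB_permA p
    · simpa [walk, letterPerm, genPerm] using permC_permB p
  | cancel x => cases x <;> simp [walk, letterPerm, Letter.inverse]
  | e_left x => simp [walk, letterPerm]
  | e_right x => simp [walk, letterPerm]

/-- The recursion for `edgeWeight` is made for this: across `ab = baa` the two weights differ by the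
indicator term alone. Every other relation preserves the weight, since `b` and `c` weigh nothing and
an edge crossed backwards counts negatively. -/
lemma abs_pathWeight_rule_sub_le {l r : Word BSGen} (h : Rule iteratedBS l r) (p : ℚ × ℤ) :
    |pathWeight l p - pathWeight r p| ≤ 1 := by
  cases h with
  | rel l r h =>
    simp only [iteratedBS, Set.mem_insert_iff, Set.mem_singleton_iff, Prod.mk.injEq] at h
    rcases h with ⟨rfl, rfl⟩ | ⟨rfl, rfl⟩
    · obtain ⟨x, k⟩ := p
      simp only [pathWeight, letterWeight, letterPerm, genPerm, permA, permB, Equiv.coe_fn_mk]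
      -- At heights `k ≤ 0` the truncation `toNat` makes all edges involved weightless.
      rcases le_or_gt k 0 with hk | hk
      · rw [Int.toNat_of_nonpos hk, Int.toNat_of_nonpos (by omega)]
        simp [edgeWeight]
      · obtain ⟨n, rfl⟩ : ∃ n : ℕ, k = n + 1 := ⟨(k - 1).toNat, by omega⟩
        have h1 : ((n : ℤ) + 1).toNat = n + 1 := by omega
        have h2 : ((n : ℤ) + 1 - 1).toNat = n := by omega
        rw [h1, h2, edgeWeight]
        have h3 : (2 : ℚ) ^ ((n : ℤ) + 1 - 1) = 2 ^ n := by simp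
        rw [h3]
        split_ifs <;> simp
    · simp [pathWeight, letterWeight]
  | cancel x =>
    cases x with
    | e => simp [pathWeight, letterWeight, Letter.inverse]
    | gen s => cases s <;> simp [pathWeight, letterWeight, Letter.inverse, letterPerm, genPerm]
    | inv s => cases s <;> simp [pathWeight, letterWeight, Letter.inverse, letterPerm, genPerm]
  | e_left x => simp [pathWeight, letterWeight, letterPerm]
  | e_right x => simp [pathWeight, letterWeight]

lemma abs_pathWeight_step_sub_le {w w' : Word BSGen} (h : Step iteratedBS w w') (p : ℚ × ℤ) :
    |pathWeight w p - pathWeight w' p| ≤ 1 := by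
  obtain ⟨u, v, l, r, hr, rfl, rfl⟩ := h
  have key : ∀ l r : Word BSGen, Rule iteratedBS l r →
      |pathWeight (u ++ l ++ v) p - pathWeight (u ++ r ++ v) p| ≤ 1 := by
    intro l r hr
    have h1 := walk_rule hr (walk u p)
    have h2 := abs_pathWeight_rule_sub_le hr (walk u p)
    simp only [pathWeight_append, walk_append, h1]
    convert h2 using 2
    ring
  rcases hr with hr | hr
  · exact key l r hr
  · rw [abs_sub_comm]
    exact key r l hr

/-- Both halves of an aligned edge are aligned one level down, so the weight counts the inner nodes
of a full binary tree of depth `k`. -/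
lemma edgeWeight_mul_two_pow (k : ℕ) (m : ℤ) : edgeWeight k (m * 2 ^ k) = 2 ^ k - 1 := by
  induction k generalizing m with
  | zero => simp [edgeWeight]
  | succ k ih =>
    have h1 : (m : ℚ) * 2 ^ (k + 1) = ((2 * m : ℤ) : ℚ) * 2 ^ k := by push_cast; ring
    have h2 : ((2 * m : ℤ) : ℚ) * 2 ^ k + 2 ^ k = ((2 * m + 1 : ℤ) : ℚ) * 2 ^ k := by
      push_cast; ring
    rw [edgeWeight, if_pos ⟨m, rfl⟩, h1, h2, ih, ih]
    ring

lemma edgeWeight_odd (k : ℕ) (m : ℤ) (hm : Odd m) : edgeWeight k m = 0 := by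
  induction k generalizing m with
  | zero => simp [edgeWeight]
  | succ k ih =>
    have h0 : ¬ ∃ j : ℤ, (m : ℚ) = j * 2 ^ (k + 1) := by
      rintro ⟨j, hj⟩
      have : m = j * 2 ^ (k + 1) := by exact_mod_cast hj
      rw [this, pow_succ, ← mul_assoc] at hm
      exact (Int.not_odd_iff_even.mpr (even_two.mul_left _)) hm
    rw [edgeWeight, if_neg h0, ih m hm]
    -- For `k = 0` the second half starts at an even integer, but edges of height 0 weigh 0 anyway.
    rcases k with _ | k
    · simp [edgeWeight]
    · have : (m : ℚ) + 2 ^ (k + 1) = ((m + 2 ^ (k + 1) : ℤ) : ℚ) := by push_cast; ring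
      rw [this, ih _ (hm.add_even (by rw [pow_succ]; exact even_two.mul_left _))]
      simp

/-- The word `c⁻ⁿ b cⁿ`, or its inverse, according to the letter in the middle. -/
def conjWord (x : Letter BSGen) : ℕ → Word BSGen
  | 0 => [x]
  | n + 1 => Letter.inv BSGen.c :: (conjWord x n ++ [Letter.gen BSGen.c])

lemma conjWord_length (x : Letter BSGen) (n : ℕ) : (conjWord x n).length = 2 * n + 1 := by
  induction n with
  | zero => rfl
  | succ n ih => simp [conjWord, ih]; ring

/-- Conjugation by `permC` doubles a vertical displacement. The intermediate orbit is irrelevant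
because the path returns to the original one, so the choice of `orbitEquiv` plays no role. -/
lemma walk_conjWord (x : Letter BSGen) (j : ℤ)
    (hx : ∀ p, letterPerm x p = (p.1, p.2 + j)) (n : ℕ) (p : ℚ × ℤ) :
    walk (conjWord x n) p = (p.1, p.2 + 2 ^ n * j) := by
  induction n generalizing p with
  | zero => simp [conjWord, walk, hx]
  | succ n ih =>
    obtain ⟨q, rfl⟩ := permC.surjective p
    simp only [conjWord, walk, walk_append, letterPerm, genPerm, ih]
    rw [show permC⁻¹ (permC q) = q from permC.symm_apply_apply q, permC_apply, permC_apply]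
    ext
    · rfl
    · simp only; ring

lemma pathWeight_conjWord (x : Letter BSGen) (hx : ∀ p, letterWeight x p = 0) (n : ℕ)
    (p : ℚ × ℤ) : pathWeight (conjWord x n) p = 0 := by
  induction n generalizing p with
  | zero => simp [conjWord, pathWeight, hx]
  | succ n ih => simp [conjWord, pathWeight, pathWeight_append, letterWeight, ih]

/-- The commutator of `a` and its conjugate by `c⁻ⁿ b cⁿ = b ^ (2 ^ n)`. -/
def deepWord (n : ℕ) : Word BSGen :=
  conjWord (Letter.inv BSGen.b) n ++ [Letter.gen BSGen.a] ++ conjWord (Letter.gen BSGen.b) n ++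
    [Letter.gen BSGen.a] ++ conjWord (Letter.inv BSGen.b) n ++ [Letter.inv BSGen.a] ++
    conjWord (Letter.gen BSGen.b) n ++ [Letter.inv BSGen.a]

lemma deepWord_length (n : ℕ) : (deepWord n).length = 8 * n + 8 := by
  simp [deepWord, conjWord_length]; ring

/-- Four `a`-edges are crossed: two at height 0, which weigh 0, and two at height `2 ^ n`. The
latter start at 0 (aligned, full weight) and at 1 (odd, weight 0), so the weights of the commutator
do not cancel. -/
lemma pathWeight_deepWord (n : ℕ) : pathWeight (deepWord n) (0, 0) = 2 ^ 2 ^ n - 1 := by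
  have hb : ∀ p, letterPerm (Letter.gen BSGen.b) p = (p.1, p.2 + -1) := fun p => rfl
  have hb' : ∀ p, letterPerm (Letter.inv BSGen.b) p = (p.1, p.2 + 1) := fun p => rfl
  have ha : ∀ p, letterPerm (Letter.gen BSGen.a) p = (p.1 + 2 ^ p.2, p.2) := fun p => rfl
  have ha' : ∀ p, letterPerm (Letter.inv BSGen.a) p = (p.1 - 2 ^ p.2, p.2) := fun p => rfl
  have hw : ∀ p : ℚ × ℤ, permA⁻¹ p = (p.1 - 2 ^ p.2, p.2) := fun p => rfl
  have c1 := pathWeight_conjWord (Letter.gen BSGen.b) (fun _ => rfl) n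
  have c2 := pathWeight_conjWord (Letter.inv BSGen.b) (fun _ => rfl) n
  simp only [deepWord, pathWeight_append, walk_append, walk, pathWeight, walk_conjWord _ _ hb,
    walk_conjWord _ _ hb', c1, c2, letterWeight, ha, ha', hw]
  have h1 : ((0 : ℤ) + 2 ^ n * 1).toNat = 2 ^ n := by
    rw [zero_add, mul_one]; exact_mod_cast Int.toNat_natCast (2 ^ n)
  have h2 : ((0 : ℤ) + 2 ^ n * 1 + 2 ^ n * -1) = 0 := by ring
  have h3 : (2 : ℚ) ^ ((0 : ℤ) + 2 ^ n * 1) = 2 ^ 2 ^ n := by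
    rw [zero_add, mul_one]; exact_mod_cast zpow_natCast (2 : ℚ) (2 ^ n)
  rw [h2, h1, h3]
  have e1 := edgeWeight_mul_two_pow (2 ^ n) 0
  have e2 := edgeWeight_odd (2 ^ n) 1 odd_one
  simp only [Int.cast_zero, zero_mul, Int.cast_one] at e1 e2
  simp [e1, e2, edgeWeight]

/-! ### Triviality of the commutator word -/

lemma Word.eval_append {S : Type} (R : Set (Word S × Word S)) (u v : Word S) :
    Word.eval R (u ++ v) = Word.eval R u * Word.eval R v := by
  simp [Word.eval, Word.toFreeGroup]

lemma Word.eval_cons {S : Type} (R : Set (Word S × Word S)) (x : Letter S) (v : Word S) :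
    Word.eval R (x :: v) = Word.eval R [x] * Word.eval R v := by
  rw [← Word.eval_append]; rfl

lemma Word.eval_inv_singleton {S : Type} (R : Set (Word S × Word S)) (s : S) :
    Word.eval R [Letter.inv s] = (Word.eval R [Letter.gen s])⁻¹ := by
  simp [Word.eval, Word.toFreeGroup, Letter.toFreeGroup]

lemma Word.eval_replicate_e {S : Type} (R : Set (Word S × Word S)) (n : ℕ) :
    Word.eval R (List.replicate n Letter.e) = 1 := by
  simp [Word.eval, Word.toFreeGroup, Letter.toFreeGroup]

lemma Word.eval_eq_of_mem {S : Type} {R : Set (Word S × Word S)} {l r : Word S}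
    (h : (l, r) ∈ R) : Word.eval R l = Word.eval R r := by
  rw [← mul_inv_eq_one]
  simp only [Word.eval]
  rw [← map_inv, ← map_mul]
  exact (PresentedGroup.mk_eq_one_iff).mpr (Subgroup.subset_normalClosure ⟨(l, r), h, rfl⟩)

lemma conj_pow_two_pow {G : Type*} [Group G] {x y : G} (h : y⁻¹ * x * y = x ^ 2) (n : ℕ) :
    (y ^ n)⁻¹ * x * y ^ n = x ^ 2 ^ n := by
  induction n with
  | zero => simp
  | succ n ih =>
    calc (y ^ (n + 1))⁻¹ * x * y ^ (n + 1) = y⁻¹ * ((y ^ n)⁻¹ * x * y ^ n) * y := by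
          rw [pow_succ]; group
      _ = (y⁻¹ * x * y) ^ 2 ^ n := by
          rw [ih]; simpa using (conj_pow (i := 2 ^ n) (a := y⁻¹) (b := x)).symm
      _ = x ^ 2 ^ (n + 1) := by rw [h, ← pow_mul, pow_succ']

lemma eval_deepWord (n : ℕ) : Word.eval iteratedBS (deepWord n) = 1 := by
  set A := Word.eval iteratedBS [Letter.gen BSGen.a] with hA
  set B := Word.eval iteratedBS [Letter.gen BSGen.b] with hB
  set C := Word.eval iteratedBS [Letter.gen BSGen.c] with hC
  have rel (l r) (h : (l, r) ∈ iteratedBS) := Word.eval_eq_of_mem h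
  have hAB : B⁻¹ * A * B = A ^ 2 := by
    have := rel _ _ (Set.mem_insert _ _)
    rw [Word.eval_cons, Word.eval_cons _ _ [_, _], Word.eval_cons _ _ [_]] at this
    simp only [← hA, ← hB] at this
    rw [mul_assoc, this, sq]; group
  have hBC : C⁻¹ * B * C = B ^ 2 := by
    have := rel _ _ (Set.mem_insert_of_mem _ (Set.mem_singleton _))
    rw [Word.eval_cons, Word.eval_cons _ _ [_, _], Word.eval_cons _ _ [_]] at this
    simp only [← hB, ← hC] at this
    rw [mul_assoc, this, sq]; group
  have key (x : Letter BSGen) :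
      Word.eval iteratedBS (conjWord x n) = (C ^ n)⁻¹ * Word.eval iteratedBS [x] * C ^ n := by
    induction n with
    | zero => simp [conjWord]
    | succ n ih =>
      rw [conjWord, Word.eval_cons, Word.eval_append, ih, Word.eval_inv_singleton, ← hC, pow_succ]
      group
  have k1 : Word.eval iteratedBS (conjWord (Letter.gen BSGen.b) n) = B ^ 2 ^ n := by
    rw [key, ← hB, conj_pow_two_pow hBC]
  have k2 : Word.eval iteratedBS (conjWord (Letter.inv BSGen.b) n) = (B ^ 2 ^ n)⁻¹ := by
    rw [key, Word.eval_inv_singleton, ← hB, ← conj_pow_two_pow hBC]; group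
  have k3 := conj_pow_two_pow hAB (2 ^ n)
  simp only [deepWord, Word.eval_append, k1, k2, Word.eval_inv_singleton, ← hA]
  calc _ = ((B ^ 2 ^ n)⁻¹ * A * B ^ 2 ^ n) * A * ((B ^ 2 ^ n)⁻¹ * A * B ^ 2 ^ n)⁻¹ * A⁻¹ := by
        group
    _ = 1 := by rw [k3]; group

/-! ### Counting the words of a derivation -/

lemma pathWeight_replicate_e (n : ℕ) (p : ℚ × ℤ) :
    pathWeight (List.replicate n Letter.e) p = 0 := by
  induction n generalizing p with
  | zero => rfl
  | succ n ih => simp [List.replicate_succ, pathWeight, letterWeight, ih]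

/-- A discrete intermediate value theorem along a chain. -/
lemma exists_mem_eq_of_isChain {α : Type*} {r : α → α → Prop} (f : α → ℤ)
    (hf : ∀ x y, r x y → |f x - f y| ≤ 1) (j : ℤ) :
    ∀ (D : List α) (x y : α), D.IsChain r → D.head? = some x → D.getLast? = some y →
      j ≤ f x → f y ≤ j → ∃ u ∈ D, f u = j := by
  intro D
  induction D with
  | nil => intro x y _ h; simp at h
  | cons z D ih =>
    intro x y hD hx hy hjx hyj
    obtain rfl : z = x := by simpa using hx
    cases D with
    | nil =>
      obtain rfl : z = y := by simpa using hy
      exact ⟨z, by simp, le_antisymm hyj hjx⟩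
    | cons z' D =>
      rw [List.isChain_cons_cons] at hD
      by_cases h : j ≤ f z'
      · obtain ⟨u, hu, hfu⟩ := ih z' y hD.2 rfl (by simpa using hy) h hyj
        exact ⟨u, List.mem_cons_of_mem _ hu, hfu⟩
      -- Here `f z' < j ≤ f z`, and a jump of at most 1 leaves only `f z = j`.
      · have := abs_le.mp (hf _ _ hD.1)
        exact ⟨z, by simp, by omega⟩

/-- An injective code of the letters by nonzero numbers. -/
def letterCode : Letter BSGen → Fin 8
  | Letter.e => 1
  | Letter.gen BSGen.a => 2
  | Letter.gen BSGen.b => 3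
  | Letter.gen BSGen.c => 4
  | Letter.inv BSGen.a => 5
  | Letter.inv BSGen.b => 6
  | Letter.inv BSGen.c => 7

lemma letterCode_injective : Function.Injective (fun x : Option (Letter BSGen) =>
    x.elim 0 letterCode) := by
  rintro (_ | _ | ⟨_ | _ | _⟩ | ⟨_ | _ | _⟩) (_ | _ | ⟨_ | _ | _⟩ | ⟨_ | _ | _⟩) h <;>
    first | rfl | (simp [letterCode] at h)

lemma card_le_of_injective_word {ι : Type*} [Fintype ι] (u : ι → Word BSGen) (Q : ℕ)
    (hu : Function.Injective u) (hQ : ∀ i, (u i).length ≤ Q) : Fintype.card ι ≤ 8 ^ Q := by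
  -- The value 0 pads a word beyond its end, so words of different lengths also get different codes.
  have : Function.Injective (fun (i : ι) (q : Fin Q) => ((u i)[(q : ℕ)]?).elim 0 letterCode) := by
    intro i j hij
    apply hu
    apply List.ext_getElem?
    intro q
    by_cases hq : q < Q
    · exact letterCode_injective (congrFun hij ⟨q, hq⟩)
    · rw [List.getElem?_eq_none (by have := hQ i; omega),
        List.getElem?_eq_none (by have := hQ j; omega)]
  simpa using Fintype.card_le_of_injective _ this

lemma le_relativeEL_of_pathWeight (w w' : Word BSGen) (N Q : ℕ) (p : ℚ × ℤ)
    (hw : pathWeight w p = 2 ^ N - 1) (hw' : pathWeight w' p = 0) (hQ : 3 * Q < N) :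
    (Q : ℕ∞) ≤ relativeEL iteratedBS w w' := by
  refine le_iInf₂ fun D hD => ?_
  by_contra! hlt
  have hlen : ∀ u ∈ D, u.length ≤ Q := by
    intro u hu
    have h1 : (u.length : ℕ∞) ≤ derivationEL D := le_iSup₂ (f := fun u (_ : u ∈ D) =>
      (u.length : ℕ∞)) u hu
    exact_mod_cast (h1.trans_lt hlt).le
  -- One word is chosen for each weight; different weights force different words, even if the
  -- derivation repeats itself.
  have hex : ∀ j : Fin (2 ^ N), ∃ u ∈ D, pathWeight u p = (j : ℕ) := by
    intro j
    refine exists_mem_eq_of_isChain (fun u => pathWeight u p)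
      (fun x y h => abs_pathWeight_step_sub_le h p) _ D w w' hD.1 hD.2.1 hD.2.2 ?_ ?_
    · have := j.2
      have h2 : ((j : ℕ) : ℤ) < 2 ^ N := by exact_mod_cast this
      rw [hw]; omega
    · rw [hw']; positivity
  choose u huD hu using hex
  have hinj : Function.Injective u := by
    intro i j hij
    have := hu i
    rw [hij, hu j] at this
    exact Fin.ext (by exact_mod_cast this.symm)
  have := card_le_of_injective_word u Q hinj (fun i => hlen _ (huD i))
  rw [Fintype.card_fin, show 8 = 2 ^ 3 by norm_num, ← pow_mul,
    Nat.pow_le_pow_iff_right (by norm_num)] at this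
  omega

lemma le_expansionLength (L n Q : ℕ) (hn : 8 * n + 8 ≤ L) (hQ : 3 * Q < 2 ^ n) :
    (Q : ℕ∞) ≤ expansionLength iteratedBS L := by
  set w := deepWord n ++ List.replicate (L - (8 * n + 8)) Letter.e with hw
  have hwL : w ∈ sector iteratedBS 1 L := by
    refine ⟨?_, ?_⟩
    · simp only [hw, List.length_append, deepWord_length, List.length_replicate]; omega
    · rw [hw, Word.eval_append, eval_deepWord, Word.eval_replicate_e, one_mul]
  have heL : List.replicate L Letter.e ∈ sector iteratedBS 1 L :=
    ⟨by simp, Word.eval_replicate_e _ _⟩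
  refine le_trans ?_ (le_iSup₂_of_le w hwL (le_iSup₂_of_le _ heL le_rfl))
  refine le_relativeEL_of_pathWeight w _ (2 ^ n) Q (0, 0) ?_ (pathWeight_replicate_e _ _) hQ
  rw [hw, pathWeight_append, pathWeight_deepWord, pathWeight_replicate_e, add_zero]

lemma length_le_expansionLength (L : ℕ) : (L : ℕ∞) ≤ expansionLength iteratedBS L := by
  have heL : List.replicate L Letter.e ∈ sector iteratedBS 1 L :=
    ⟨by simp, Word.eval_replicate_e _ _⟩
  refine le_trans ?_ (le_iSup₂_of_le _ heL (le_iSup₂_of_le _ heL le_rfl))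
  refine le_iInf₂ fun D hD => ?_
  have : List.replicate L Letter.e ∈ D := List.mem_of_head? hD.2.1
  refine le_trans ?_ (le_iSup₂ (f := fun u (_ : u ∈ D) => (u.length : ℕ∞)) _ this)
  simp

lemma two_pow_le_expansionLength (L : ℕ) (hL : 1 ≤ L) :
    (2 : ℕ∞) ^ (L / 32) ≤ expansionLength iteratedBS L := by
  by_cases h : L < 32
  · rw [Nat.div_eq_of_lt h, pow_zero]
    exact le_trans (by exact_mod_cast hL) (length_le_expansionLength L)
  -- For `L ≥ 32` one has `L / 32 + 2 ≤ L / 8 - 1`, which absorbs the factor 3.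
  · have := le_expansionLength L (L / 8 - 1) (2 ^ (L / 32)) (by omega) ?_
    · exact_mod_cast this
    · calc 3 * 2 ^ (L / 32) < 2 ^ (L / 32 + 2) := by
            have := Nat.one_le_two_pow (n := L / 32)
            rw [pow_add]; omega
        _ ≤ _ := Nat.pow_le_pow_right (by norm_num) (by omega)

end LowerBound

/-! ### Bounded rewriting in the free group -/

section BoundedRewriting

noncomputable instance : DecidableEq BSGen := Classical.decEq _

/-- The generator `a` of the free group. -/
def genA : FreeGroup BSGen := FreeGroup.of BSGen.a

/-- The generator `b` of the free group. -/
def genB : FreeGroup BSGen := FreeGroup.of BSGen.b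

/-- The generator `c` of the free group. -/
def genC : FreeGroup BSGen := FreeGroup.of BSGen.c

/-- The defining relations, as pairs of elements of the free group. -/
inductive BSRel : FreeGroup BSGen → FreeGroup BSGen → Prop
  | ab : BSRel (genA * genB) (genB * genA * genA)
  | bc : BSRel (genB * genC) (genC * genB * genB)

/-- One application of a defining relation to an element of the free group, with a bound on the
length of the words involved. -/
def BoundedStep (K : ℕ) (g h : FreeGroup BSGen) : Prop :=
  ∃ u v l r, (BSRel l r ∨ BSRel r l) ∧ u.norm + v.norm + 3 ≤ K ∧ g = u * l * v ∧ h = u * r * v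

/-- Rewriting between elements of the free group, with a bound on the length of the words
involved. -/
def BoundedEquiv (K : ℕ) : FreeGroup BSGen → FreeGroup BSGen → Prop :=
  Relation.ReflTransGen (BoundedStep K)

namespace BoundedEquiv

lemma of_eq {K : ℕ} {g h : FreeGroup BSGen} (e : g = h) : BoundedEquiv K g h :=
  e ▸ Relation.ReflTransGen.refl

lemma trans {K : ℕ} {g h k : FreeGroup BSGen} (h₁ : BoundedEquiv K g h)
    (h₂ : BoundedEquiv K h k) : BoundedEquiv K g k :=
  Relation.ReflTransGen.trans h₁ h₂

lemma symm {K : ℕ} {g h : FreeGroup BSGen} (h₁ : BoundedEquiv K g h) : BoundedEquiv K h g := by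
  induction h₁ with
  | refl => exact Relation.ReflTransGen.refl
  | tail _ h₂ ih =>
    obtain ⟨u, v, l, r, hr, hK, e₁, e₂⟩ := h₂
    exact Relation.ReflTransGen.head ⟨u, v, r, l, hr.symm, hK, e₂, e₁⟩ ih

lemma map {K K' : ℕ} {g h : FreeGroup BSGen} (f : FreeGroup BSGen → FreeGroup BSGen)
    (hf : ∀ x y, BoundedStep K x y → BoundedStep K' (f x) (f y)) (h₁ : BoundedEquiv K g h) :
    BoundedEquiv K' (f g) (f h) := by
  induction h₁ with
  | refl => exact Relation.ReflTransGen.refl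
  | tail _ h₂ ih => exact Relation.ReflTransGen.tail ih (hf _ _ h₂)

lemma mono {K K' : ℕ} {g h : FreeGroup BSGen} (h₁ : BoundedEquiv K g h) (hK : K ≤ K') :
    BoundedEquiv K' g h := by
  refine h₁.map id ?_
  rintro x y ⟨u, v, l, r, hr, hK', e₁, e₂⟩
  exact ⟨u, v, l, r, hr, hK'.trans hK, e₁, e₂⟩

lemma context {K : ℕ} {g h : FreeGroup BSGen} (h₁ : BoundedEquiv K g h) (p q : FreeGroup BSGen)
    {K' : ℕ} (hK : K + p.norm + q.norm ≤ K') : BoundedEquiv K' (p * g * q) (p * h * q) := by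
  refine h₁.map (fun x => p * x * q) ?_
  rintro x y ⟨u, v, l, r, hr, hK', rfl, rfl⟩
  refine ⟨p * u, v * q, l, r, hr, ?_, by group, by group⟩
  have := FreeGroup.norm_mul_le p u
  have := FreeGroup.norm_mul_le v q
  omega

lemma mul_left {K : ℕ} {g h : FreeGroup BSGen} (h₁ : BoundedEquiv K g h) (p : FreeGroup BSGen)
    {K' : ℕ} (hK : K + p.norm ≤ K') : BoundedEquiv K' (p * g) (p * h) := by
  simpa using h₁.context p 1 (by simpa using hK)

lemma mul_right {K : ℕ} {g h : FreeGroup BSGen} (h₁ : BoundedEquiv K g h) (q : FreeGroup BSGen)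
    {K' : ℕ} (hK : K + q.norm ≤ K') : BoundedEquiv K' (g * q) (h * q) := by
  simpa using h₁.context 1 q (by simpa using hK)

end BoundedEquiv

lemma norm_genA : genA.norm = 1 := FreeGroup.norm_of _

lemma norm_genB : genB.norm = 1 := FreeGroup.norm_of _

lemma norm_genC : genC.norm = 1 := FreeGroup.norm_of _

lemma norm_mul_le_add {g h : FreeGroup BSGen} {m n : ℕ} (hg : g.norm ≤ m) (hh : h.norm ≤ n) :
    (g * h).norm ≤ m + n :=
  (FreeGroup.norm_mul_le g h).trans (add_le_add hg hh)

lemma BSRel.norm_le {l r : FreeGroup BSGen} (h : BSRel l r) : l.norm ≤ 3 ∧ r.norm ≤ 3 := by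
  have hA := norm_genA.le
  have hB := norm_genB.le
  have hC := norm_genC.le
  cases h
  · exact ⟨(norm_mul_le_add hA hB).trans (by norm_num),
      norm_mul_le_add (norm_mul_le_add hB hA) hA⟩
  · exact ⟨(norm_mul_le_add hB hC).trans (by norm_num),
      norm_mul_le_add (norm_mul_le_add hC hB) hB⟩

/-- Inverses of the relations are not themselves steps. Instead `l⁻¹ = r⁻¹ r l⁻¹` becomes `r⁻¹ l l⁻¹
= r⁻¹`, which lengthens the context by at most 6. -/
lemma BoundedEquiv.inv {K : ℕ} {g h : FreeGroup BSGen} (h₁ : BoundedEquiv K g h)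
    {K' : ℕ} (hK : K + 6 ≤ K') : BoundedEquiv K' g⁻¹ h⁻¹ := by
  refine h₁.map (fun x => x⁻¹) ?_
  rintro x y ⟨u, v, l, r, hr, hK', rfl, rfl⟩
  have hl : l.norm ≤ 3 ∧ r.norm ≤ 3 := by
    rcases hr with hr | hr
    · exact hr.norm_le
    · exact hr.norm_le.symm
  refine ⟨v⁻¹ * r⁻¹, l⁻¹ * u⁻¹, r, l, hr.symm, ?_, by group, by group⟩
  have h1 := FreeGroup.norm_mul_le v⁻¹ r⁻¹
  have h2 := FreeGroup.norm_mul_le l⁻¹ u⁻¹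
  simp only [FreeGroup.norm_inv_eq] at h1 h2
  omega

lemma norm_zpow_le (s : BSGen) (k : ℤ) : (FreeGroup.of s ^ k).norm ≤ k.natAbs := by
  obtain ⟨n, rfl | rfl⟩ := k.eq_nat_or_neg
  · simp
  · simp [FreeGroup.norm_inv_eq]

lemma norm_genB_zpow_le (k : ℤ) : (genB ^ k).norm ≤ k.natAbs := norm_zpow_le _ k

/-! ### Arithmetic of conjugates of `a` in bounded space -/

/-- The conjugate `b⁻ʰ a^ε bʰ`, which is the power `a ^ (ε 2 ^ h)` if `h ≥ 0`. -/
def conjA (x : ℤ × ℤˣ) : FreeGroup BSGen := genB ^ (-x.1) * genA ^ (x.2 : ℤ) * genB ^ x.1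

lemma norm_conjA_le (x : ℤ × ℤˣ) : (conjA x).norm ≤ 2 * x.1.natAbs + 1 := by
  have h1 := norm_genB_zpow_le (-x.1)
  have h2 := norm_genB_zpow_le x.1
  have h3 : (genA ^ (x.2 : ℤ)).norm ≤ 1 := by
    refine (norm_zpow_le _ _).trans ?_
    rcases Int.units_eq_one_or x.2 with h | h <;> simp [h]
  have := norm_mul_le_add (norm_mul_le_add h1 h3) h2
  rw [Int.natAbs_neg] at this
  rw [conjA]
  omega

lemma conjA_mul_self (h : ℤ) (ε : ℤˣ) {K : ℕ} (hK : 2 * h.natAbs + 12 ≤ K) :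
    BoundedEquiv K (conjA (h, ε) * conjA (h, ε)) (conjA (h + 1, ε)) := by
  have h1 : BoundedEquiv 4 (genA * genA) (genB⁻¹ * genA * genB) :=
    Relation.ReflTransGen.single
      ⟨genB⁻¹, 1, _, _, Or.inr BSRel.ab, by simp [FreeGroup.norm_inv_eq, norm_genB],
        by group, by group⟩
  have h2 : BoundedEquiv 10 (genA ^ (ε : ℤ) * genA ^ (ε : ℤ))
      (genB⁻¹ * genA ^ (ε : ℤ) * genB) := by
    rcases Int.units_eq_one_or ε with rfl | rfl
    · simpa using h1.mono (by norm_num)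
    · have := h1.inv (K' := 10) (by norm_num)
      simpa [mul_assoc] using this
  have h3 := h2.context (genB ^ (-h)) (genB ^ h) (K' := K) (by
    have h4 := norm_genB_zpow_le (-h)
    have h5 := norm_genB_zpow_le h
    rw [Int.natAbs_neg] at h4
    omega)
  convert h3 using 1
  · simp only [conjA]; group
  · simp only [conjA]; group

/-- A conjugate of height `d + 1` is split into two of height `d`, which pass `a^δ` one after the
other and are merged again. The number of steps doubles with `d`, but space is reused: each level
only adds one spectator of linear length, so the total is quadratic. -/
lemma conjA_comm_nat (d : ℕ) (ε δ : ℤˣ) :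
    BoundedEquiv (2 * d ^ 2 + 2 * d + 12) (conjA (d, ε) * genA ^ (δ : ℤ))
      (genA ^ (δ : ℤ) * conjA (d, ε)) := by
  have hδ : (genA ^ (δ : ℤ)).norm ≤ 1 := by simpa [conjA] using norm_conjA_le (0, δ)
  induction d with
  | zero =>
    refine BoundedEquiv.of_eq ?_
    simp [conjA, ← zpow_add, add_comm]
  | succ d ih =>
    have hd := norm_conjA_le (d, ε)
    simp only [Int.natAbs_natCast] at hd
    have h1 := conjA_mul_self d ε (K := 2 * d + 12) (by simp)
    have hc : 2 * (d + 1) ^ 2 + 2 * (d + 1) + 12 = 2 * d ^ 2 + 6 * d + 16 := by ring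
    have h2 := (h1.mul_right (genA ^ (δ : ℤ)) (K' := 2 * (d + 1) ^ 2 + 2 * (d + 1) + 12)
      (by rw [hc]; nlinarith)).symm
    have h3 := ih.mul_left (conjA (d, ε)) (K' := 2 * (d + 1) ^ 2 + 2 * (d + 1) + 12)
      (by rw [hc]; nlinarith)
    have h4 := ih.mul_right (conjA (d, ε)) (K' := 2 * (d + 1) ^ 2 + 2 * (d + 1) + 12)
      (by rw [hc]; nlinarith)
    have h5 := h1.mul_left (genA ^ (δ : ℤ)) (K' := 2 * (d + 1) ^ 2 + 2 * (d + 1) + 12)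
      (by rw [hc]; nlinarith)
    simp only [mul_assoc] at h2 h3 h4 h5 ⊢
    push_cast
    exact h2.trans (h3.trans (h4.trans h5))

lemma conjA_comm (x y : ℤ × ℤˣ) (H : ℕ) (hx : x.1.natAbs ≤ H) (hy : y.1.natAbs ≤ H) :
    BoundedEquiv (8 * H ^ 2 + 6 * H + 12) (conjA x * conjA y) (conjA y * conjA x) := by
  have key : ∀ x y : ℤ × ℤˣ, x.1.natAbs ≤ H → y.1.natAbs ≤ H → y.1 ≤ x.1 →
      BoundedEquiv (8 * H ^ 2 + 6 * H + 12) (conjA x * conjA y) (conjA y * conjA x) := by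
    rintro ⟨h, ε⟩ ⟨k, δ⟩ hx hy hxy
    dsimp only at hx hy hxy
    obtain ⟨d, rfl⟩ : ∃ d : ℕ, h = k + d := ⟨(h - k).toNat, by omega⟩
    have h1 := norm_genB_zpow_le (-k)
    have h2 := norm_genB_zpow_le k
    rw [Int.natAbs_neg] at h1
    -- The gap between two heights in `[-H, H]` turns `2 d ^ 2 + 2 d` into `8 H ^ 2 + 4 H`;
    -- conjugation by `b ^ k` costs another `2 H`.
    have hd : d ≤ 2 * H := by omega
    have h3 := (conjA_comm_nat d ε δ).context (genB ^ (-k)) (genB ^ k)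
      (K' := 8 * H ^ 2 + 6 * H + 12) (by nlinarith)
    convert h3 using 1
    · simp only [conjA, zpow_add]; group
    · simp only [conjA, zpow_add]; group
  rcases le_total y.1 x.1 with h | h
  · exact key x y hx hy h
  · exact (key y x hy hx h).symm

/-- A product of conjugates of `a` and `a⁻¹` by powers of `b`. -/
def prodConjA (l : List (ℤ × ℤˣ)) : FreeGroup BSGen := (l.map conjA).prod

@[simp] lemma prodConjA_nil : prodConjA [] = 1 := rfl

@[simp] lemma prodConjA_cons (x : ℤ × ℤˣ) (l : List (ℤ × ℤˣ)) :
    prodConjA (x :: l) = conjA x * prodConjA l := by simp [prodConjA]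

lemma norm_prodConjA_le (l : List (ℤ × ℤˣ)) (H : ℕ) (hl : ∀ x ∈ l, x.1.natAbs ≤ H) :
    (prodConjA l).norm ≤ l.length * (2 * H + 1) := by
  induction l with
  | nil => simp
  | cons x l ih =>
    rw [List.forall_mem_cons] at hl
    have := norm_mul_le_add (norm_conjA_le x) (ih hl.2)
    rw [prodConjA_cons, List.length_cons]
    nlinarith [hl.1]

lemma prodConjA_perm {l l' : List (ℤ × ℤˣ)} (hp : l.Perm l') (H : ℕ)
    (hl : ∀ x ∈ l, x.1.natAbs ≤ H) :
    BoundedEquiv (l.length * (2 * H + 1) + (8 * H ^ 2 + 6 * H + 12)) (prodConjA l)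
      (prodConjA l') := by
  induction hp with
  | nil => exact BoundedEquiv.of_eq rfl
  | cons x _ ih =>
    rw [List.forall_mem_cons] at hl
    rw [prodConjA_cons, prodConjA_cons]
    refine (ih hl.2).mul_left _ ?_
    have := norm_conjA_le x
    rw [List.length_cons]
    nlinarith [hl.1]
  | swap x y l =>
    simp only [List.forall_mem_cons] at hl
    simp only [prodConjA_cons, ← mul_assoc]
    refine (conjA_comm y x H hl.1 hl.2.1).mul_right _ ?_
    have := norm_prodConjA_le l H hl.2.2
    simp only [List.length_cons]
    nlinarith
  | trans h₁ h₂ ih₁ ih₂ =>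
    refine (ih₁ hl).trans ?_
    rw [h₁.length_eq]
    exact ih₂ (fun x hx => hl x (h₁.mem_iff.mpr hx))

/-- The dyadic number represented by a list of heights and signs. -/
def dyadicSum (l : List (ℤ × ℤˣ)) : ℚ := (l.map fun x => ((x.2 : ℤ) : ℚ) * 2 ^ x.1).sum

@[simp] lemma dyadicSum_nil : dyadicSum [] = 0 := rfl

@[simp] lemma dyadicSum_cons (x : ℤ × ℤˣ) (l : List (ℤ × ℤˣ)) :
    dyadicSum (x :: l) = ((x.2 : ℤ) : ℚ) * 2 ^ x.1 + dyadicSum l := by simp [dyadicSum]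

lemma dyadicSum_perm {l l' : List (ℤ × ℤˣ)} (hp : l.Perm l') : dyadicSum l = dyadicSum l' :=
  (hp.map _).sum_eq

lemma exists_dyadicSum_eq (l : List (ℤ × ℤˣ)) (h : ℤ) (hl : ∀ x ∈ l, h < x.1) :
    ∃ m : ℤ, dyadicSum l = m * 2 ^ (h + 1) := by
  induction l with
  | nil => exact ⟨0, by simp⟩
  | cons x l ih =>
    rw [List.forall_mem_cons] at hl
    obtain ⟨m, hm⟩ := ih hl.2
    obtain ⟨d, hd⟩ : ∃ d : ℕ, x.1 = h + 1 + d := ⟨(x.1 - h - 1).toNat, by omega⟩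
    refine ⟨x.2 * 2 ^ d + m, ?_⟩
    rw [dyadicSum_cons, hm, hd, zpow_add₀ (by norm_num : (2 : ℚ) ≠ 0) (h + 1)]
    push_cast
    rw [zpow_natCast]
    ring

/-- Parity: if the least height occurred only once, dividing the sum by that power of 2 would leave
an odd integer. -/
lemma exists_perm_of_dyadicSum_eq_zero (l : List (ℤ × ℤˣ)) (hl : l ≠ [])
    (h0 : dyadicSum l = 0) :
    ∃ (h : ℤ) (ε δ : ℤˣ) (l' : List (ℤ × ℤˣ)), l.Perm ((h, ε) :: (h, δ) :: l') := by
  obtain ⟨x, hx, hmin⟩ : ∃ x ∈ l, ∀ y ∈ l, x.1 ≤ y.1 := by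
    obtain ⟨x, hx, hmin⟩ := Finset.exists_min_image l.toFinset Prod.fst
      (by simpa [List.toFinset_nonempty_iff] using hl)
    exact ⟨x, by simpa using hx, by simpa using hmin⟩
  have hp := List.perm_cons_erase hx
  by_cases hy : ∃ y ∈ l.erase x, y.1 = x.1
  · obtain ⟨y, hy, hyx⟩ := hy
    refine ⟨x.1, x.2, y.2, (l.erase x).erase y, hp.trans ?_⟩
    have : (x.1, y.2) = y := by rw [← hyx]
    rw [this]
    exact (List.perm_cons_erase hy).cons _
  · push Not at hy
    exfalso
    have hlt : ∀ y ∈ l.erase x, x.1 < y.1 := fun y hyl =>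
      lt_of_le_of_ne (hmin y (List.mem_of_mem_erase hyl)) (hy y hyl).symm
    obtain ⟨m, hm⟩ := exists_dyadicSum_eq _ _ hlt
    rw [dyadicSum_perm hp, dyadicSum_cons, hm, zpow_add_one₀ (by norm_num)] at h0
    have h1 : (2 : ℚ) ^ x.1 ≠ 0 := by positivity
    have h2 : ((x.2 : ℤ) : ℚ) + m * 2 = 0 := by
      have : (2 : ℚ) ^ x.1 * (((x.2 : ℤ) : ℚ) + m * 2) = 0 := by linarith
      simpa [h1] using this
    have h3 : (x.2 : ℤ) + m * 2 = 0 := by exact_mod_cast h2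
    rcases Int.units_eq_one_or x.2 with h | h <;> simp [h] at h3 <;> omega

/-- Two factors of equal height either cancel or merge into one of height `h + 1`. A merge raises a
height by one but removes a factor, so height plus number of factors stays below `N`, and the space
needed is quadratic in `N`. -/
lemma prodConjA_of_dyadicSum_eq_zero (N n : ℕ) (l : List (ℤ × ℤˣ)) (hn : l.length = n)
    (hl : ∀ x ∈ l, x.1.natAbs + n ≤ N) (h0 : dyadicSum l = 0) :
    BoundedEquiv (N * (2 * N + 1) + (8 * N ^ 2 + 6 * N + 12)) (prodConjA l) 1 := by
  induction n using Nat.strong_induction_on generalizing l with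
  | _ n ih =>
    by_cases hnil : l = []
    · subst hnil; exact BoundedEquiv.of_eq rfl
    obtain ⟨h, ε, δ, l', hp⟩ := exists_perm_of_dyadicSum_eq_zero l hnil h0
    have hlen : n = l'.length + 2 := by rw [← hn, hp.length_eq]; rfl
    have hl' : ∀ x ∈ (h, ε) :: (h, δ) :: l', x.1.natAbs + n ≤ N :=
      fun x hx => hl x (hp.mem_iff.mpr hx)
    have hnN : n ≤ N := le_trans (by omega) (hl' _ (List.mem_cons_self ..))
    have hperm := (prodConjA_perm hp N (fun x hx => by have := hl x hx; omega)).mono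
      (K' := N * (2 * N + 1) + (8 * N ^ 2 + 6 * N + 12)) (by rw [hn]; gcongr)
    refine hperm.trans ?_
    rw [dyadicSum_perm hp] at h0
    simp only [List.forall_mem_cons] at hl'
    simp only [dyadicSum_cons] at h0
    simp only [prodConjA_cons, ← mul_assoc]
    by_cases hεδ : ε = δ
    · subst hεδ
      have hnorm := norm_prodConjA_le l' N (fun x hx => by have := hl'.2.2 x hx; omega)
      have h1 := (conjA_mul_self h ε (K := 2 * N + 12) (by have := hl'.1; omega)).mul_right
        (prodConjA l') (K' := N * (2 * N + 1) + (8 * N ^ 2 + 6 * N + 12)) (by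
          have : l'.length * (2 * N + 1) ≤ N * (2 * N + 1) := by gcongr; omega
          nlinarith)
      refine h1.trans ?_
      rw [← prodConjA_cons]
      refine ih (n - 1) (by omega) _ (by simp [hlen]) ?_ ?_
      · rw [List.forall_mem_cons]
        refine ⟨?_, fun x hx => by have := hl'.2.2 x hx; omega⟩
        have := hl'.1
        dsimp only at this ⊢
        omega
      · rw [dyadicSum_cons, zpow_add_one₀ (by norm_num)]
        linarith
    · have hδ : δ = -ε := by
        rcases Int.units_eq_one_or ε with rfl | rfl <;>
          rcases Int.units_eq_one_or δ with rfl | rfl <;> simp_all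
      subst hδ
      have h1 : conjA (h, ε) * conjA (h, -ε) = 1 := by
        simp only [conjA, Units.val_neg, zpow_neg]; group
      rw [h1, one_mul]
      refine ih (n - 2) (by omega) l' (by omega)
        (fun x hx => by have := hl'.2.2 x hx; omega) ?_
      push_cast at h0
      linarith

/-! ### Conjugating powers of `b` by `c` -/

lemma genC_conj_pow (n : ℕ) :
    BoundedEquiv (3 * n + 4) (genC⁻¹ * genB ^ n * genC) (genB ^ (2 * n)) := by
  induction n with
  | zero => exact BoundedEquiv.of_eq (by simp)
  | succ n ih =>
    have h1 : BoundedEquiv 4 (genC⁻¹ * genB * genC) (genB ^ 2) :=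
      Relation.ReflTransGen.single
        ⟨genC⁻¹, 1, _, _, Or.inl BSRel.bc, by simp [FreeGroup.norm_inv_eq, norm_genC],
          by group, by rw [sq]; group⟩
    have hb : (genB ^ (2 * n)).norm = 2 * n := FreeGroup.norm_of_pow _ _
    have hn : (genC⁻¹ * genB * genC).norm ≤ 3 :=
      norm_mul_le_add (norm_mul_le_add (by rw [FreeGroup.norm_inv_eq, norm_genC])
        norm_genB.le) norm_genC.le
    have h2 := ih.mul_right (genC⁻¹ * genB * genC) (K' := 3 * (n + 1) + 4) (by omega)
    have h3 := h1.mul_left (genB ^ (2 * n)) (K' := 3 * (n + 1) + 4) (by omega)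
    have e : genC⁻¹ * genB ^ (n + 1) * genC
        = genC⁻¹ * genB ^ n * genC * (genC⁻¹ * genB * genC) := by
      rw [pow_succ]; group
    rw [e, show 2 * (n + 1) = 2 * n + 2 by ring, pow_add]
    exact h2.trans h3

lemma genC_conj_zpow (k : ℤ) {K : ℕ} (hK : 3 * k.natAbs + 10 ≤ K) :
    BoundedEquiv K (genC⁻¹ * genB ^ k * genC) (genB ^ (2 * k)) := by
  obtain ⟨n, rfl | rfl⟩ := k.eq_nat_or_neg
  · rw [Int.natAbs_natCast] at hK
    have := (genC_conj_pow n).mono (K' := K) (by omega)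
    exact_mod_cast this
  · rw [Int.natAbs_neg, Int.natAbs_natCast] at hK
    have := (genC_conj_pow n).inv (K' := K) (by omega)
    convert this using 1
    · simp [mul_assoc]
    · rw [← zpow_natCast, ← zpow_neg]; push_cast; ring_nf

end BoundedRewriting

/-! ### Reduced forms -/

section ReducedForms

/-! ### An affine model of `⟨a, b⟩` and its HNN extension -/

/-- The affine maps `x ↦ 2 ^ k x + t` of the rational line. -/
@[ext]
structure DyadicAffine : Type where
  /-- The translation part. -/
  shift : ℚ
  /-- The exponent of the scaling factor. -/
  scale : ℤ

namespace DyadicAffine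

instance : Mul DyadicAffine := ⟨fun p q => ⟨p.shift + 2 ^ p.scale * q.shift, p.scale + q.scale⟩⟩

instance : One DyadicAffine := ⟨⟨0, 0⟩⟩

instance : Inv DyadicAffine := ⟨fun p => ⟨-(2 ^ (-p.scale) * p.shift), -p.scale⟩⟩

lemma mul_def (p q : DyadicAffine) :
    p * q = ⟨p.shift + 2 ^ p.scale * q.shift, p.scale + q.scale⟩ := rfl

lemma one_def : (1 : DyadicAffine) = ⟨0, 0⟩ := rfl

lemma inv_def (p : DyadicAffine) : p⁻¹ = ⟨-(2 ^ (-p.scale) * p.shift), -p.scale⟩ := rfl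

instance : Group DyadicAffine :=
  Group.ofLeftAxioms
    (fun p q r => by
      simp only [mul_def, zpow_add₀ (two_ne_zero : (2 : ℚ) ≠ 0), mk.injEq]
      constructor <;> ring)
    (fun p => by simp [mul_def, one_def])
    (fun p => by simp [mul_def, one_def, inv_def])

/-- The homomorphism that sends `1` to the `n`-th power of the scaling by `1 / 2`. -/
def scaling (n : ℤ) : Multiplicative ℤ →* DyadicAffine where
  toFun k := ⟨0, -(n * k.toAdd)⟩
  map_one' := by simp [one_def]
  map_mul' k m := by simp [mul_def]; ring

lemma scaling_apply (n : ℤ) (k : Multiplicative ℤ) : scaling n k = ⟨0, -(n * k.toAdd)⟩ := rfl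

lemma scaling_injective {n : ℤ} (hn : n ≠ 0) : Function.Injective (scaling n) := by
  intro k m h
  simpa [scaling_apply, hn] using h

lemma zpow_mk_zero (h k : ℤ) : (⟨0, h⟩ : DyadicAffine) ^ k = ⟨0, h * k⟩ := by
  have := map_zpow (scaling (-h)) (Multiplicative.ofAdd 1) k
  rw [← ofAdd_zsmul] at this
  simpa [scaling_apply] using this.symm

end DyadicAffine

open DyadicAffine HNNExtension

/-- The subgroup generated by `b`. -/
abbrev subB : Subgroup DyadicAffine := (scaling 1).range

/-- The subgroup generated by `b²`. -/
abbrev subBSq : Subgroup DyadicAffine := (scaling 2).range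

/-- The isomorphism that sends `b` to `b²`. -/
noncomputable def squareEquiv : subB ≃* subBSq :=
  (MonoidHom.ofInjective (scaling_injective one_ne_zero)).symm.trans
    (MonoidHom.ofInjective (scaling_injective two_ne_zero))

lemma squareEquiv_scaling (k : Multiplicative ℤ) :
    (squareEquiv ⟨scaling 1 k, k, rfl⟩ : DyadicAffine) = scaling 2 k := by
  have : (⟨scaling 1 k, k, rfl⟩ : subB) =
      MonoidHom.ofInjective (scaling_injective one_ne_zero) k := rfl
  rw [this, squareEquiv, MulEquiv.trans_apply, MulEquiv.symm_apply_apply]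
  rfl

/-- The iterated Baumslag-Solitar group, over the affine maps, as an HNN extension. -/
abbrev BSExtension : Type := HNNExtension DyadicAffine subB subBSq squareEquiv

/-- The images of the generators in the HNN extension. -/
noncomputable def genImage : BSGen → BSExtension
  | BSGen.a => of ⟨1, 0⟩
  | BSGen.b => of ⟨0, -1⟩
  | BSGen.c => t⁻¹

/-- The homomorphism from the free group to the HNN extension. -/
noncomputable def toExtension : FreeGroup BSGen →* BSExtension := FreeGroup.lift genImage

lemma toExtension_genA : toExtension genA = of ⟨1, 0⟩ := by simp [toExtension, genA, genImage]

lemma toExtension_genB : toExtension genB = of ⟨0, -1⟩ := by simp [toExtension, genB, genImage]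

lemma toExtension_genC : toExtension genC = t⁻¹ := by simp [toExtension, genC, genImage]

lemma toExtension_eq_of_rel {l r : FreeGroup BSGen} (h : BSRel l r) :
    toExtension l = toExtension r := by
  cases h
  · simp only [map_mul, toExtension_genA, toExtension_genB, ← map_mul of, mul_def]
    norm_num
  · simp only [map_mul, toExtension_genB, toExtension_genC]
    have h1 := t_mul_of (φ := squareEquiv) ⟨scaling 1 (Multiplicative.ofAdd 1), _, rfl⟩
    rw [squareEquiv_scaling] at h1
    simp only [scaling_apply] at h1
    have h2 : (of ⟨0, -1⟩ : BSExtension) * of ⟨0, -1⟩ = of ⟨0, -2⟩ := by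
      rw [← map_mul, mul_def]; norm_num
    have h3 : (t : BSExtension) * of ⟨0, -1⟩ = of ⟨0, -2⟩ * t := by simpa using h1
    rw [mul_assoc, h2, eq_inv_mul_iff_mul_eq, ← mul_assoc, h3, mul_inv_cancel_right]

lemma BoundedEquiv.toExtension_eq {K : ℕ} {g h : FreeGroup BSGen} (h₁ : BoundedEquiv K g h) :
    toExtension g = toExtension h := by
  induction h₁ with
  | refl => rfl
  | tail _ h₂ ih =>
    obtain ⟨u, v, l, r, hr, hK, rfl, rfl⟩ := h₂
    rw [ih]
    simp only [map_mul]
    rcases hr with hr | hr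
    · rw [toExtension_eq_of_rel hr]
    · rw [toExtension_eq_of_rel hr]

/-! ### Syllables and Britton reduction -/

/-- An element of the subgroup generated by `a` and `b`: a product of conjugates of `a` by powers
of `b`, followed by a power of `b`. -/
abbrev Syllable : Type := List (ℤ × ℤˣ) × ℤ

/-- The element of the free group given by a syllable. -/
def Syllable.val (s : Syllable) : FreeGroup BSGen := prodConjA s.1 * genB ^ s.2

/-- The affine map given by a syllable. -/
def Syllable.aff (s : Syllable) : DyadicAffine := ⟨dyadicSum s.1, -s.2⟩

/-- Bounds on the size of a syllable. -/
def Syllable.Bounded (n H : ℕ) (s : Syllable) : Prop :=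
  s.1.length ≤ n ∧ (∀ x ∈ s.1, x.1.natAbs ≤ H) ∧ s.2.natAbs ≤ H

lemma Syllable.Bounded.mono {n n' H H' : ℕ} {s : Syllable} (h : s.Bounded n H) (hn : n ≤ n')
    (hH : H ≤ H') : s.Bounded n' H' :=
  ⟨h.1.trans hn, fun x hx => (h.2.1 x hx).trans hH, h.2.2.trans hH⟩

lemma Syllable.Bounded.norm_le {n H : ℕ} {s : Syllable} (h : s.Bounded n H) :
    s.val.norm ≤ n * (2 * H + 1) + H :=
  norm_mul_le_add ((norm_prodConjA_le _ H h.2.1).trans (by gcongr; exact h.1))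
    ((norm_genB_zpow_le _).trans h.2.2)

lemma toExtension_conjA (x : ℤ × ℤˣ) :
    toExtension (conjA x) = of ⟨((x.2 : ℤ) : ℚ) * 2 ^ x.1, 0⟩ := by
  have h1 : (⟨1, 0⟩ : DyadicAffine) ^ (x.2 : ℤ) = ⟨((x.2 : ℤ) : ℚ), 0⟩ := by
    rcases Int.units_eq_one_or x.2 with h | h <;> simp [h, inv_def]
  simp only [conjA, map_mul, map_zpow, toExtension_genA, toExtension_genB]
  simp only [← map_zpow, ← map_mul of, zpow_mk_zero, h1, mul_def]
  simp [mul_comm]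

lemma toExtension_prodConjA (l : List (ℤ × ℤˣ)) :
    toExtension (prodConjA l) = of ⟨dyadicSum l, 0⟩ := by
  induction l with
  | nil => simp [← one_def]
  | cons x l ih =>
    rw [prodConjA_cons, map_mul, toExtension_conjA, ih, ← map_mul, mul_def]
    simp

lemma toExtension_val (s : Syllable) : toExtension s.val = of s.aff := by
  rw [Syllable.val, map_mul, toExtension_prodConjA, map_zpow, toExtension_genB, ← map_zpow,
    zpow_mk_zero, ← map_mul, mul_def, Syllable.aff]
  simp

lemma genB_zpow_mul_prodConjA (k : ℤ) (l : List (ℤ × ℤˣ)) :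
    genB ^ k * prodConjA l = prodConjA (l.map fun x => (x.1 - k, x.2)) * genB ^ k := by
  induction l with
  | nil => simp
  | cons x l ih =>
    rw [List.map_cons, prodConjA_cons, prodConjA_cons, mul_assoc (conjA _), ← ih]
    simp only [conjA, zpow_sub, neg_sub]
    group

/-- The product of a power of `b` and a syllable. -/
def Syllable.translate (k : ℤ) (s : Syllable) : Syllable :=
  (s.1.map fun x => (x.1 - k, x.2), k + s.2)

lemma Syllable.val_translate (k : ℤ) (s : Syllable) :
    (s.translate k).val = genB ^ k * s.val := by
  rw [Syllable.val, Syllable.val, ← mul_assoc, genB_zpow_mul_prodConjA, Syllable.translate,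
    zpow_add, mul_assoc]

lemma Syllable.Bounded.translate {n H : ℕ} {s : Syllable} (h : s.Bounded n H) (k : ℤ) :
    (s.translate k).Bounded n (H + k.natAbs) := by
  refine ⟨by simpa [Syllable.translate] using h.1, ?_, ?_⟩
  · intro y hy
    simp only [Syllable.translate, List.mem_map] at hy
    obtain ⟨x, hx, rfl⟩ := hy
    have := h.2.1 x hx
    dsimp only
    omega
  · have := h.2.2
    simp only [Syllable.translate]
    omega

/-- The element of the free group given by a list of syllables, each of them after `c^±1`. -/
def tailVal (L : List (ℤˣ × Syllable)) : FreeGroup BSGen :=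
  (L.map fun y => genC ^ (-(y.1 : ℤ)) * y.2.val).prod

@[simp] lemma tailVal_nil : tailVal [] = 1 := rfl

@[simp] lemma tailVal_cons (y : ℤˣ × Syllable) (L : List (ℤˣ × Syllable)) :
    tailVal (y :: L) = genC ^ (-(y.1 : ℤ)) * y.2.val * tailVal L := by simp [tailVal]

lemma norm_genC_zpow_le (ε : ℤˣ) : (genC ^ (ε : ℤ)).norm ≤ 1 := by
  refine (norm_zpow_le _ _).trans ?_
  rcases Int.units_eq_one_or ε with h | h <;> simp [h]

lemma norm_tailVal_le (L : List (ℤˣ × Syllable)) (n H : ℕ) (hL : ∀ y ∈ L, y.2.Bounded n H) :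
    (tailVal L).norm ≤ L.length * (n * (2 * H + 1) + H + 1) := by
  induction L with
  | nil => simp
  | cons y L ih =>
    rw [List.forall_mem_cons] at hL
    have h0 : (genC ^ (-(y.1 : ℤ))).norm ≤ 1 := by
      rw [zpow_neg, FreeGroup.norm_inv_eq]; exact norm_genC_zpow_le _
    have := norm_mul_le_add (norm_mul_le_add h0 hL.1.norm_le) (ih hL.2)
    rw [tailVal_cons, List.length_cons]
    linarith

/-- The condition of Britton's lemma. -/
def IsReducedTail (L : List (ℤˣ × Syllable)) : Prop :=
  L.IsChain fun x y => x.2.aff ∈ toSubgroup subB subBSq x.1 → x.1 = y.1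

/-- Britton's lemma. -/
lemma tail_eq_nil_of_toExtension_eq_one (s : Syllable) (L : List (ℤˣ × Syllable))
    (hL : IsReducedTail L) (h : toExtension (s.val * tailVal L) = 1) : L = [] := by
  -- Since `c` maps to `t⁻¹`, the factor `c ^ (-ε)` in `tailVal` is `t ^ ε`.
  let w : NormalWord.ReducedWord DyadicAffine subB subBSq :=
    { head := s.aff
      toList := L.map fun y => (y.1, y.2.aff)
      chain := by rw [List.isChain_map]; exact hL }
  have hw : w.prod squareEquiv = toExtension (s.val * tailVal L) := by
    rw [map_mul, toExtension_val, NormalWord.ReducedWord.prod, tailVal, map_list_prod,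
      List.map_map, List.map_map]
    congr 3
    funext y
    simp [toExtension_val, toExtension_genC]
  have := HNNExtension.ReducedWord.toList_eq_nil_of_mem_of_range squareEquiv w
    (by rw [hw, h]; exact one_mem _)
  simpa [w] using this

lemma eq_of_aff_mem_range {s : Syllable} {n : ℤ} (h : s.aff ∈ (scaling n).range) :
    dyadicSum s.1 = 0 ∧ ∃ m : ℤ, s.2 = n * m := by
  obtain ⟨k, hk⟩ := h
  rw [scaling_apply, Syllable.aff, DyadicAffine.mk.injEq, neg_inj] at hk
  exact ⟨hk.1.symm, k.toAdd, hk.2.symm⟩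

lemma Syllable.Bounded.val_equiv {n H N : ℕ} {s : Syllable} (h : s.Bounded n H)
    (h0 : dyadicSum s.1 = 0) (hN : n + H ≤ N) {K : ℕ} (hK : 10 * N ^ 2 + 8 * N + 12 ≤ K) :
    BoundedEquiv K s.val (genB ^ s.2) := by
  have h1 := prodConjA_of_dyadicSum_eq_zero N s.1.length s.1 rfl
    (fun x hx => by have := h.2.1 x hx; have := h.1; omega) h0
  have h2 := h1.mul_right (genB ^ s.2) (K' := K) (by
    have := norm_genB_zpow_le s.2
    have := h.2.2
    nlinarith)
  simpa [Syllable.val] using h2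

/-- A syllable in the associated subgroup has translation part 0, so its conjugates of `a` can be
merged away. What remains is a power of `b`, whose exponent conjugation doubles or halves. -/
lemma exists_pinch {n H N : ℕ} {s : Syllable} (h : s.Bounded n H) (ε : ℤˣ)
    (hs : s.aff ∈ toSubgroup subB subBSq ε) (hN : n + H ≤ N) {K : ℕ}
    (hK : 10 * N ^ 2 + 8 * N + 14 ≤ K) :
    ∃ k : ℤ, k.natAbs ≤ 2 * H ∧
      BoundedEquiv K (genC ^ (-(ε : ℤ)) * s.val * genC ^ (ε : ℤ)) (genB ^ k) := by
  have hctx : dyadicSum s.1 = 0 → BoundedEquiv K (genC ^ (-(ε : ℤ)) * s.val * genC ^ (ε : ℤ))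
      (genC ^ (-(ε : ℤ)) * genB ^ s.2 * genC ^ (ε : ℤ)) := fun h0 => by
    refine (h.val_equiv h0 hN le_rfl).context _ _ ?_
    have := norm_genC_zpow_le ε
    rw [zpow_neg, FreeGroup.norm_inv_eq]
    omega
  have hH := h.2.2
  rcases Int.units_eq_one_or ε with rfl | rfl
  · obtain ⟨h0, m, hm⟩ := eq_of_aff_mem_range hs
    refine ⟨2 * s.2, by omega, (hctx h0).trans ?_⟩
    have := genC_conj_zpow s.2 (K := K) (by nlinarith)
    simpa using this
  · obtain ⟨h0, m, hm⟩ := eq_of_aff_mem_range hs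
    refine ⟨m, by omega, (hctx h0).trans ?_⟩
    -- The doubling rule is read backwards: `b ^ (2 m)` becomes `c⁻¹ b ^ m c` between `c` and `c⁻¹`.
    have := (genC_conj_zpow m (K := 3 * m.natAbs + 10) le_rfl).symm.context genC genC⁻¹ (K' := K)
      (by rw [FreeGroup.norm_inv_eq, norm_genC]; have : m.natAbs ≤ H := by omega
          nlinarith)
    rw [← hm] at this
    convert this using 1
    · simp
    · group

/-- A reduced form `s c^∓1 s₁ c^∓1 s₂ ⋯` with bounds on its size. -/
structure IsReducedForm (n : ℕ) (s : Syllable) (L : List (ℤˣ × Syllable)) : Prop where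
  length_le : L.length ≤ n
  head_bounded : s.Bounded n (4 ^ n)
  tail_bounded : ∀ y ∈ L, y.2.Bounded n (4 ^ n)
  reduced : IsReducedTail L

lemma IsReducedForm.norm_le {n M : ℕ} {s : Syllable} {L : List (ℤˣ × Syllable)}
    (h : IsReducedForm n s L) (hM : 4 ^ n ≤ M) :
    (s.val * tailVal L).norm ≤ 2 * M ^ 3 + 4 * M ^ 2 + 3 * M := by
  have hn : n ≤ M := (Nat.lt_pow_self (by norm_num)).le.trans hM
  have h1 := (h.head_bounded.mono hn hM).norm_le
  have h2 := norm_tailVal_le L M M (fun y hy => (h.tail_bounded y hy).mono hn hM)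
  have h3 : L.length * (M * (2 * M + 1) + M + 1) ≤ M * (M * (2 * M + 1) + M + 1) := by
    gcongr; exact h.length_le.trans hn
  refine (norm_mul_le_add h1 (h2.trans h3)).trans (le_of_eq ?_)
  ring

lemma IsReducedForm.mono {n : ℕ} {s : Syllable} {L : List (ℤˣ × Syllable)}
    (h : IsReducedForm n s L) (s' : Syllable) (hs' : s'.Bounded (n + 1) (4 ^ (n + 1))) :
    IsReducedForm (n + 1) s' L :=
  ⟨h.length_le.trans n.le_succ, hs', fun y hy => (h.tail_bounded y hy).mono n.le_succ
    (Nat.pow_le_pow_right (by norm_num) n.le_succ), h.reduced⟩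

lemma IsReducedForm.mul_genA {n : ℕ} {s : Syllable} {L : List (ℤˣ × Syllable)}
    (h : IsReducedForm n s L) (ε : ℤˣ) :
    ∃ s', IsReducedForm (n + 1) s' L ∧
      genA ^ (ε : ℤ) * (s.val * tailVal L) = s'.val * tailVal L := by
  have hH : 4 ^ n ≤ 4 ^ (n + 1) := Nat.pow_le_pow_right (by norm_num) n.le_succ
  refine ⟨((0, ε) :: s.1, s.2), h.mono _ ⟨?_, ?_, h.head_bounded.2.2.trans hH⟩, ?_⟩
  · simpa using h.head_bounded.1
  · rw [List.forall_mem_cons]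
    exact ⟨by simp, fun x hx => (h.head_bounded.2.1 x hx).trans hH⟩
  · simp [Syllable.val, conjA, mul_assoc]

lemma IsReducedForm.mul_genB {n : ℕ} {s : Syllable} {L : List (ℤˣ × Syllable)}
    (h : IsReducedForm n s L) (ε : ℤˣ) :
    ∃ s', IsReducedForm (n + 1) s' L ∧
      genB ^ (ε : ℤ) * (s.val * tailVal L) = s'.val * tailVal L := by
  refine ⟨s.translate ε, h.mono _ ((h.head_bounded.translate _).mono n.le_succ ?_), ?_⟩
  · have : (ε : ℤ).natAbs = 1 := by rcases Int.units_eq_one_or ε with h | h <;> simp [h]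
    have h1 := Nat.one_le_pow n 4 (by norm_num)
    rw [this, pow_succ]
    omega
  · rw [Syllable.val_translate, mul_assoc]

/-- Prepending `c^±1` either keeps the form reduced or creates a single pinch at the front. The
pinch becomes `b ^ k`, which is absorbed by the next syllable; the rest of the tail is untouched and
still reduced. -/
lemma IsReducedForm.mul_genC {n M : ℕ} {s : Syllable} {L : List (ℤˣ × Syllable)}
    (h : IsReducedForm n s L) (hM : 4 ^ n ≤ M) (ε : ℤˣ) :
    ∃ s' L', IsReducedForm (n + 1) s' L' ∧
      BoundedEquiv (100 * M ^ 3) (genC ^ (-(ε : ℤ)) * (s.val * tailVal L))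
        (s'.val * tailVal L') := by
  have hH : 4 ^ n ≤ 4 ^ (n + 1) := Nat.pow_le_pow_right (by norm_num) n.le_succ
  have h1M : 1 ≤ M := (Nat.one_le_pow n 4 (by norm_num)).trans hM
  have hM12 : M ≤ M ^ 2 := Nat.le_self_pow (by norm_num) M
  have hM23 : M ^ 2 ≤ M ^ 3 := Nat.pow_le_pow_right h1M (by norm_num)
  by_cases hred : IsReducedTail ((ε, s) :: L)
  · refine ⟨([], 0), (ε, s) :: L, ⟨by simpa using h.length_le, ?_, ?_, hred⟩, ?_⟩
    · simp [Syllable.Bounded]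
    · rw [List.forall_mem_cons]
      exact ⟨h.head_bounded.mono n.le_succ hH,
        fun y hy => (h.tail_bounded y hy).mono n.le_succ hH⟩
    · refine BoundedEquiv.of_eq ?_
      simp [Syllable.val, mul_assoc]
  · rcases L with _ | ⟨⟨δ, s₁⟩, L⟩
    · exact absurd (List.isChain_singleton _) hred
    have hchain := h.reduced
    rw [IsReducedTail, List.isChain_cons_cons] at hred
    have hpinch : s.aff ∈ toSubgroup subB subBSq ε ∧ ε ≠ δ := by
      by_contra hcon
      refine hred ⟨fun hmem => ?_, hchain⟩
      by_contra hne
      exact hcon ⟨hmem, hne⟩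
    have hδ : δ = -ε := by
      have := hpinch.2
      rcases Int.units_eq_one_or ε with rfl | rfl <;>
        rcases Int.units_eq_one_or δ with rfl | rfl <;> simp_all
    subst hδ
    have hn : n ≤ M := (Nat.lt_pow_self (by norm_num)).le.trans hM
    obtain ⟨k, hk, hequiv⟩ := exists_pinch (N := 2 * M) h.head_bounded ε hpinch.1 (by omega) le_rfl
    have hb := List.forall_mem_cons.mp h.tail_bounded
    have hrest : IsReducedForm n s₁ L :=
      ⟨by have := h.length_le; simp at this; omega, hb.1, hb.2, hchain.tail⟩
    refine ⟨s₁.translate k, L, hrest.mono _ ((hb.1.translate k).mono n.le_succ ?_), ?_⟩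
    -- Exponents grow from `H` to at most `H + 2 H`; this is where the base 4 has room.
    · rw [pow_succ]; omega
    · have := hequiv.mul_right (s₁.val * tailVal L) (K' := 100 * M ^ 3) (by
        have := hrest.norm_le hM
        nlinarith)
      rw [Syllable.val_translate]
      convert this using 1
      · simp [mul_assoc]
      · rw [mul_assoc]

lemma exists_isReducedForm (M : ℕ) (w : List (BSGen × Bool)) (hM : 4 ^ w.length ≤ M) :
    ∃ s L, IsReducedForm w.length s L ∧
      BoundedEquiv (100 * M ^ 3 + w.length) (FreeGroup.mk w) (s.val * tailVal L) := by
  induction w with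
  | nil =>
    refine ⟨([], 0), [], ⟨le_rfl, by simp [Syllable.Bounded], by simp, List.isChain_nil⟩, ?_⟩
    exact BoundedEquiv.of_eq (by simp [Syllable.val, ← FreeGroup.one_eq_mk])
  | cons x w ih =>
    have hM' : 4 ^ w.length ≤ M :=
      (Nat.pow_le_pow_right (by norm_num) (Nat.le_succ _)).trans hM
    obtain ⟨s, L, hform, hequiv⟩ := ih hM'
    obtain ⟨ε, hε⟩ : ∃ ε : ℤˣ, FreeGroup.mk (x :: w) =
        FreeGroup.of x.1 ^ (ε : ℤ) * FreeGroup.mk w := by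
      obtain ⟨g, _ | _⟩ := x
      · exact ⟨-1, by simp [FreeGroup.of, FreeGroup.inv_mk, FreeGroup.invRev, FreeGroup.mul_mk]⟩
      · exact ⟨1, by simp [FreeGroup.of, FreeGroup.mul_mk]⟩
    have hnorm : (FreeGroup.of x.1 ^ (ε : ℤ)).norm ≤ 1 := by
      refine (norm_zpow_le _ _).trans ?_
      rcases Int.units_eq_one_or ε with h | h <;> simp [h]
    have hstep := hequiv.mul_left (FreeGroup.of x.1 ^ (ε : ℤ))
      (K' := 100 * M ^ 3 + (x :: w).length) (by rw [List.length_cons]; omega)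
    rw [← hε] at hstep
    obtain ⟨g, b⟩ := x
    cases g with
    | a =>
      obtain ⟨s', hs', e⟩ := hform.mul_genA ε
      exact ⟨s', L, hs', hstep.trans (BoundedEquiv.of_eq e)⟩
    | b =>
      obtain ⟨s', hs', e⟩ := hform.mul_genB ε
      exact ⟨s', L, hs', hstep.trans (BoundedEquiv.of_eq e)⟩
    | c =>
      obtain ⟨s', L', hs', e⟩ := hform.mul_genC hM' (-ε)
      refine ⟨s', L', hs', hstep.trans ?_⟩
      simpa [genC] using e.mono (Nat.le_add_right _ _)

/-- Britton's lemma leaves one syllable, and injectivity of the base group in the extension gives it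
translation part 0 and exponent 0. -/
lemma boundedEquiv_one_of_toExtension_eq_one (w : List (BSGen × Bool))
    (hw : toExtension (FreeGroup.mk w) = 1) :
    BoundedEquiv (100 * (4 ^ w.length) ^ 3 + w.length) (FreeGroup.mk w) 1 := by
  obtain ⟨s, L, hform, hequiv⟩ := exists_isReducedForm _ w le_rfl
  refine hequiv.trans ?_
  rw [hequiv.toExtension_eq] at hw
  obtain rfl := tail_eq_nil_of_toExtension_eq_one s L hform.reduced hw
  rw [tailVal_nil, mul_one] at hw ⊢
  rw [toExtension_val, ← map_one (of (φ := squareEquiv))] at hw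
  have h1 := of_injective _ hw
  rw [Syllable.aff, one_def, DyadicAffine.mk.injEq, neg_eq_zero] at h1
  have hn : w.length ≤ 4 ^ w.length := (Nat.lt_pow_self (by norm_num)).le
  have h2 := hform.head_bounded.val_equiv h1.1 (N := 2 * 4 ^ w.length)
    (K := 100 * (4 ^ w.length) ^ 3 + w.length) (by omega) (by
      generalize hM : 4 ^ w.length = M
      have h1M : 1 ≤ M := hM ▸ Nat.one_le_pow _ 4 (by norm_num)
      have hM12 : M ≤ M ^ 2 := Nat.le_self_pow (by norm_num) M
      have hM23 : M ^ 2 ≤ M ^ 3 := Nat.pow_le_pow_right h1M (by norm_num)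
      nlinarith)
  simpa [h1.2] using h2

end ReducedForms

/-! ### The upper bound -/

section UpperBound

/-- Derivations in which all words have length at most `K`. -/
def BoundedDerivation {S : Type} (R : Set (Word S × Word S)) (K : ℕ) : Word S → Word S → Prop :=
  Relation.ReflTransGen fun u v => Step R u v ∧ u.length ≤ K ∧ v.length ≤ K

namespace BoundedDerivation

variable {S : Type} {R : Set (Word S × Word S)} {K : ℕ} {u v w : Word S}

lemma trans (h₁ : BoundedDerivation R K u v) (h₂ : BoundedDerivation R K v w) :
    BoundedDerivation R K u w :=
  Relation.ReflTransGen.trans h₁ h₂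

lemma symm (h : BoundedDerivation R K u v) : BoundedDerivation R K v u := by
  induction h with
  | refl => exact Relation.ReflTransGen.refl
  | tail _ h₂ ih =>
    obtain ⟨⟨p, q, l, r, hr, e₁, e₂⟩, h₃, h₄⟩ := h₂
    exact Relation.ReflTransGen.head ⟨⟨p, q, r, l, hr.symm, e₂, e₁⟩, h₄, h₃⟩ ih

lemma of_rule {l r : Word S} (h : Rule R l r) (p q : Word S)
    (hl : p.length + l.length + q.length ≤ K) (hr : p.length + r.length + q.length ≤ K) :
    BoundedDerivation R K (p ++ l ++ q) (p ++ r ++ q) :=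
  Relation.ReflTransGen.single
    ⟨⟨p, q, l, r, Or.inl h, rfl, rfl⟩, by simpa [add_assoc] using hl, by simpa [add_assoc] using hr⟩

/-- A trivial letter is absorbed by the letter that follows it. -/
lemma erase_e (p q : Word S) (hq : q ≠ []) (hK : p.length + q.length + 1 ≤ K) :
    BoundedDerivation R K (p ++ Letter.e :: q) (p ++ q) := by
  obtain ⟨x, q, rfl⟩ := List.exists_cons_of_ne_nil hq
  have := of_rule (K := K) (Rule.e_left (R := R) x) p q
    (by simp at hK ⊢; omega) (by simp at hK ⊢; omega)
  simpa using this

lemma erase_cancel (x : Letter S) (p q : Word S) (hq : q ≠ [])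
    (hK : p.length + q.length + 2 ≤ K) :
    BoundedDerivation R K (p ++ x :: x.inverse :: q) (p ++ q) := by
  have := of_rule (K := K) (Rule.cancel (R := R) x) p q (by simp; omega) (by simp; omega)
  refine trans (by simpa using this) (erase_e p q hq (by omega))

lemma relativeEL_le (h : BoundedDerivation R K u v) (hu : u.length ≤ K) :
    relativeEL R u v ≤ K := by
  obtain ⟨D, hD, hlast⟩ := List.exists_isChain_cons_of_relationReflTransGen h
  refine iInf₂_le_of_le (u :: D) ⟨hD.imp fun _ _ h => h.1, rfl, ?_⟩ ?_
  · rw [List.getLast?_eq_getLast_of_ne_nil (List.cons_ne_nil _ _), hlast]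
  · refine iSup₂_le fun x hx => ?_
    have : ∀ (D : List (Word S)) (u : Word S), u.length ≤ K →
        (u :: D).IsChain (fun u v => Step R u v ∧ u.length ≤ K ∧ v.length ≤ K) →
        ∀ x ∈ u :: D, x.length ≤ K := by
      intro D
      induction D with
      | nil => intro u hu _ x hx; simp at hx; exact hx ▸ hu
      | cons y D ih =>
        intro u hu hc x hx
        rw [List.isChain_cons_cons] at hc
        rcases List.mem_cons.mp hx with rfl | hx
        · exact hu
        · exact ih y hc.1.2.2 hc.2 x hx
    exact_mod_cast this D u hu hD x hx

end BoundedDerivation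

/-! ### From the free group back to words with `e` -/

/-- The letter given by a generator and a sign. -/
def signedLetter {S : Type} (x : S × Bool) : Letter S :=
  cond x.2 (Letter.gen x.1) (Letter.inv x.1)

lemma signedLetter_not {S : Type} (s : S) (b : Bool) :
    signedLetter (s, !b) = (signedLetter (s, b)).inverse := by
  cases b <;> rfl

/-- The word given by a word of the free group, followed by a trivial letter. -/
def paddedWord {S : Type} (l : List (S × Bool)) : Word S := l.map signedLetter ++ [Letter.e]

lemma paddedWord_length {S : Type} (l : List (S × Bool)) :
    (paddedWord l).length = l.length + 1 := by simp [paddedWord]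

lemma paddedWord_append {S : Type} (l m : List (S × Bool)) :
    paddedWord (l ++ m) = l.map signedLetter ++ paddedWord m := by simp [paddedWord]

variable {S : Type} {R : Set (Word S × Word S)} {K : ℕ}

lemma boundedDerivation_of_red {l m : List (S × Bool)} (h : FreeGroup.Red l m)
    (hK : l.length + 1 ≤ K) : BoundedDerivation R K (paddedWord l) (paddedWord m) := by
  induction h with
  | refl => exact Relation.ReflTransGen.refl
  | tail hred h₂ ih =>
    refine ih.trans ?_
    have hlen := FreeGroup.Red.length_le hred
    cases h₂ with
    | not =>
      simp only [List.length_append, List.length_cons] at hlen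
      simp only [paddedWord, List.map_append, List.map_cons, List.cons_append, List.append_assoc,
        signedLetter_not]
      exact BoundedDerivation.erase_cancel _ _ _ (by simp) (by simp; omega)

/-- Free reduction is confluent and never lengthens a word, so passing through a common reduct costs
no extra space. -/
lemma boundedDerivation_of_mk_eq [DecidableEq S] {l m : List (S × Bool)}
    (h : FreeGroup.mk l = FreeGroup.mk m) (hl : l.length + 1 ≤ K) (hm : m.length + 1 ≤ K) :
    BoundedDerivation R K (paddedWord l) (paddedWord m) := by
  obtain ⟨k, h₁, h₂⟩ := FreeGroup.Red.exact.mp h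
  exact (boundedDerivation_of_red h₁ hl).trans (boundedDerivation_of_red h₂ hm).symm

/-- The word of the free group obtained from a word by erasing the trivial letters. -/
def eraseE : Word S → List (S × Bool)
  | [] => []
  | Letter.e :: w => eraseE w
  | Letter.gen s :: w => (s, true) :: eraseE w
  | Letter.inv s :: w => (s, false) :: eraseE w

lemma eraseE_length_le (w : Word S) : (eraseE w).length ≤ w.length := by
  induction w with
  | nil => rfl
  | cons x w ih => cases x <;> simp [eraseE] <;> omega

lemma mk_eraseE (w : Word S) : FreeGroup.mk (eraseE w) = Word.toFreeGroup w := by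
  induction w with
  | nil => rfl
  | cons x w ih =>
    have hcons : Word.toFreeGroup (x :: w) = x.toFreeGroup * Word.toFreeGroup w := by
      simp [Word.toFreeGroup]
    rw [hcons, ← ih]
    cases x <;> simp [eraseE, Letter.toFreeGroup, FreeGroup.of, FreeGroup.inv_mk,
      FreeGroup.invRev, FreeGroup.mul_mk]

lemma boundedDerivation_eraseE (p w : Word S) (hK : p.length + w.length + 1 ≤ K) :
    BoundedDerivation R K (p ++ w ++ [Letter.e]) (p ++ paddedWord (eraseE w)) := by
  induction w generalizing p with
  | nil =>
    simp only [eraseE, paddedWord, List.append_nil, List.map_nil, List.nil_append]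
    exact Relation.ReflTransGen.refl
  | cons x w ih =>
    rw [List.length_cons] at hK
    have hx := ih (p ++ [x]) (by simp; omega)
    cases x with
    | e =>
      have h1 := BoundedDerivation.erase_e (R := R) (K := K) p (w ++ [Letter.e]) (by simp)
        (by simp; omega)
      exact (by simpa using h1 : BoundedDerivation R K _ _).trans
        (by simpa [eraseE] using ih p (by omega))
    | gen s => simpa [eraseE, paddedWord, signedLetter] using hx
    | inv s => simpa [eraseE, paddedWord, signedLetter] using hx

lemma boundedDerivation_append_e (w : Word S) (hw : w ≠ []) (hK : w.length + 1 ≤ K) :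
    BoundedDerivation R K w (w ++ [Letter.e]) := by
  obtain ⟨p, x, rfl⟩ := List.eq_nil_or_concat' w |>.resolve_left hw
  have := BoundedDerivation.of_rule (K := K) (Rule.e_right (R := R) x) p []
    (by simp at hK ⊢; omega) (by simp at hK ⊢; omega)
  simpa using this.symm

lemma boundedDerivation_replicate_e (n : ℕ) (hK : n + 1 ≤ K) :
    BoundedDerivation R K (List.replicate (n + 1) Letter.e) [Letter.e] := by
  induction n with
  | zero => exact Relation.ReflTransGen.refl
  | succ n ih =>
    refine BoundedDerivation.trans ?_ (ih (by omega))
    have := BoundedDerivation.erase_e (R := R) (K := K) [] (List.replicate (n + 1) Letter.e)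
      (by simp) (by simp; omega)
    simpa [List.replicate_succ] using this

lemma exists_rule_of_bsRel {l r : FreeGroup BSGen} (h : BSRel l r) :
    ∃ l' r' : List (BSGen × Bool), l = FreeGroup.mk l' ∧ r = FreeGroup.mk r' ∧
      l'.length ≤ 3 ∧ r'.length ≤ 3 ∧
      Rule iteratedBS (l'.map signedLetter) (r'.map signedLetter) := by
  cases h
  · refine ⟨[(BSGen.a, true), (BSGen.b, true)], [(BSGen.b, true), (BSGen.a, true),
      (BSGen.a, true)], ?_, ?_, by simp, by simp, Rule.rel _ _ (Set.mem_insert _ _)⟩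
    · simp [genA, genB, FreeGroup.of, FreeGroup.mul_mk]
    · simp [genA, genB, FreeGroup.of, FreeGroup.mul_mk]
  · refine ⟨[(BSGen.b, true), (BSGen.c, true)], [(BSGen.c, true), (BSGen.b, true),
      (BSGen.b, true)], ?_, ?_, by simp, by simp,
      Rule.rel _ _ (Set.mem_insert_of_mem _ (Set.mem_singleton _))⟩
    · simp [genB, genC, FreeGroup.of, FreeGroup.mul_mk]
    · simp [genB, genC, FreeGroup.of, FreeGroup.mul_mk]

/-- Each free group element is represented by its reduced word. A step inserts the relation
unreduced between the reduced contexts, applies it, and reduces again; the extra 1 is the final `e`.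
-/
lemma boundedDerivation_of_boundedEquiv {g h : FreeGroup BSGen} (H : BoundedEquiv K g h) :
    BoundedDerivation iteratedBS (K + 1) (paddedWord g.toWord) (paddedWord h.toWord) := by
  have key : ∀ u v l r : FreeGroup BSGen, BSRel l r → u.norm + v.norm + 3 ≤ K →
      BoundedDerivation iteratedBS (K + 1) (paddedWord (u * l * v).toWord)
        (paddedWord (u * r * v).toWord) := by
    intro u v l r hr hK
    obtain ⟨l', r', rfl, rfl, hl', hr', hrule⟩ := exists_rule_of_bsRel hr
    have h0 : ∀ m : List (BSGen × Bool), m.length ≤ 3 → BoundedDerivation iteratedBS (K + 1)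
        (paddedWord (u * FreeGroup.mk m * v).toWord)
        (paddedWord (u.toWord ++ m ++ v.toWord)) := by
      intro m hm
      have e : FreeGroup.mk (u.toWord ++ m ++ v.toWord) = u * FreeGroup.mk m * v := by
        rw [← FreeGroup.mul_mk, ← FreeGroup.mul_mk, FreeGroup.mk_toWord, FreeGroup.mk_toWord]
      have hlen : (u.toWord ++ m ++ v.toWord).length ≤ K := by
        simp only [List.length_append]
        simp only [FreeGroup.norm] at hK
        omega
      refine boundedDerivation_of_mk_eq (by rw [FreeGroup.mk_toWord, e]) ?_ (by omega)
      have := FreeGroup.norm_mk_le (L₁ := u.toWord ++ m ++ v.toWord)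
      rw [e, FreeGroup.norm] at this
      omega
    refine (h0 l' hl').trans (BoundedDerivation.trans ?_ (h0 r' hr').symm)
    have := BoundedDerivation.of_rule (K := K + 1) hrule (u.toWord.map signedLetter)
      (paddedWord v.toWord)
      (by simp only [paddedWord_length, List.length_map]; simp only [FreeGroup.norm] at hK; omega)
      (by simp only [paddedWord_length, List.length_map]; simp only [FreeGroup.norm] at hK; omega)
    simpa [paddedWord_append] using this
  induction H with
  | refl => exact Relation.ReflTransGen.refl
  | tail _ h₂ ih =>
    refine ih.trans ?_
    obtain ⟨u, v, l, r, hr | hr, hK, rfl, rfl⟩ := h₂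
    · exact key u v l r hr hK
    · exact (key u v r l hr hK).symm

lemma toExtension_eq_one_of_eval_eq_one {w : Word BSGen} (hw : Word.eval iteratedBS w = 1) :
    toExtension (Word.toFreeGroup w) = 1 := by
  have h1 : Word.toFreeGroup w ∈ Subgroup.normalClosure (relators iteratedBS) :=
    PresentedGroup.mk_eq_one_iff.mp hw
  have h2 : Subgroup.normalClosure (relators iteratedBS) ≤ toExtension.ker := by
    refine Subgroup.normalClosure_le_normal ?_
    rintro x ⟨p, hp, rfl⟩
    have hab := toExtension_eq_of_rel BSRel.ab
    have hbc := toExtension_eq_of_rel BSRel.bc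
    simp only [iteratedBS, Set.mem_insert_iff, Set.mem_singleton_iff] at hp
    simp only [SetLike.mem_coe, MonoidHom.mem_ker, map_mul, map_inv, mul_inv_eq_one]
    rcases hp with rfl | rfl
    · simpa [Word.toFreeGroup, Letter.toFreeGroup, genA, genB, mul_assoc] using hab
    · simpa [Word.toFreeGroup, Letter.toFreeGroup, genB, genC, mul_assoc] using hbc
  exact h2 h1

/-- Every trivial word is linked to the same word `e ^ L`, so two of them are linked through it
within the same bound. -/
lemma boundedDerivation_replicate_e_of_mem {L : ℕ} {w : Word BSGen} (hL : 1 ≤ L)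
    (hw : w ∈ sector iteratedBS 1 L) :
    BoundedDerivation iteratedBS (100 * (4 ^ L) ^ 3 + L + 1) w (List.replicate L Letter.e) := by
  obtain ⟨hlen, heval⟩ := hw
  have hlen' := eraseE_length_le w
  rw [hlen] at hlen'
  have hone : toExtension (FreeGroup.mk (eraseE w)) = 1 := by
    rw [mk_eraseE]; exact toExtension_eq_one_of_eval_eq_one heval
  have hequiv := (boundedEquiv_one_of_toExtension_eq_one _ hone).mono
    (K' := 100 * (4 ^ L) ^ 3 + L) (by gcongr; norm_num)
  have h1 := boundedDerivation_append_e (R := iteratedBS) (K := 100 * (4 ^ L) ^ 3 + L + 1) w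
    (by rintro rfl; simp at hlen; omega) (by omega)
  have h2 := boundedDerivation_eraseE (R := iteratedBS) (K := 100 * (4 ^ L) ^ 3 + L + 1) [] w
    (by simp only [List.length_nil]; omega)
  have hnorm := FreeGroup.norm_mk_le (L₁ := eraseE w)
  rw [FreeGroup.norm] at hnorm
  have h3 := boundedDerivation_of_mk_eq (R := iteratedBS) (K := 100 * (4 ^ L) ^ 3 + L + 1)
    (l := eraseE w) (m := (FreeGroup.mk (eraseE w)).toWord) (by rw [FreeGroup.mk_toWord])
    (by omega) (by omega)
  have h4 := boundedDerivation_of_boundedEquiv hequiv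
  have h5 := boundedDerivation_replicate_e (R := iteratedBS)
    (K := 100 * (4 ^ L) ^ 3 + L + 1) (L - 1) (by omega)
  rw [Nat.sub_add_cancel hL] at h5
  refine h1.trans (BoundedDerivation.trans (by simpa using h2) (h3.trans (h4.trans ?_)))
  simpa [paddedWord] using h5.symm

lemma expansionLength_le_two_pow (L : ℕ) (hL : 1 ≤ L) :
    expansionLength iteratedBS L ≤ (2 : ℕ∞) ^ (32 * L) := by
  refine iSup₂_le fun w hw => iSup₂_le fun w' hw' => ?_
  have h1 := (boundedDerivation_replicate_e_of_mem hL hw).trans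
    (boundedDerivation_replicate_e_of_mem hL hw').symm
  refine (h1.relativeEL_le (by rw [hw.1]; omega)).trans ?_
  have h2 : 100 * (4 ^ L) ^ 3 + L + 1 ≤ 2 ^ (32 * L) := by
    have e1 : 2 ^ (32 * L) = (4 ^ L) ^ 3 * 2 ^ (26 * L) := by
      rw [show 4 = 2 ^ 2 by norm_num, ← pow_mul, ← pow_mul, ← pow_add]; ring_nf
    have e2 : 2 ^ 26 ≤ 2 ^ (26 * L) := Nat.pow_le_pow_right (by norm_num) (by omega)
    have e3 : L < 4 ^ L := Nat.lt_pow_self (by norm_num)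
    have e4 : 4 ^ L ≤ (4 ^ L) ^ 3 := Nat.le_self_pow (by norm_num) _
    rw [e1]
    nlinarith
  exact_mod_cast h2

end UpperBound

theorem mainTheorem3 : ScalingEquiv (expansionLength iteratedBS) (fun L : ℕ => 2 ^ L) :=
  ⟨32, by norm_num, fun L hL => ⟨two_pow_le_expansionLength L hL, expansionLength_le_two_pow L hL⟩⟩
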